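/- Let $p \neq 2$ be a prime number and let $X$ be a scheme over $\mathbb{Z}_p$ that is Noetherian, separated, and flat over $\mathbb{Z}_p$. For $n \geq 1$ put $X_{p^n} := X \times_{\operatorname{Spec} \mathbb{Z}_p} \operatorname{Spec} \mathbb{Z}/p^n\mathbb{Z}$, so that $X_p$ is the special fiber, and let $\widehat{X}$ be the formal scheme obtained by completing $X$ along $(p)$, i.e. the topological space underlying $X_p$ with the structure sheaf $\varprojlim_n \mathscr{O}_{X_{p^n}}$. Assume that $H^1(X_p, \mathscr{O}_{X_p}) = 0$. Let $P \subseteq \operatorname{Pic}(X_p)$ be the set of the classes of all invertible sheaves on $X_p$ that lift to $\widehat{X}$, i.e. that are isomorphic to the restriction to $X_p$ of an invertible sheaf on $\widehat{X}$. Then $P$ is a subgroup of $\operatorname{Pic}(X_p)$ and the quotient group $\operatorname{Pic}(X_p)/P$ is torsion-free. -/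

import Mathlib

open CategoryTheory MonoidalCategory TopologicalSpace Opposite AlgebraicGeometry
universe u
namespace PicardLift
/-- Sheaves of commutative rings on a topological space. -/
abbrev RingSheaf (T : TopCat.{u}) := Sheaf (Opens.grothendieckTopology T) CommRingCat.{u}

variable {T : TopCat.{u}} (R : RingSheaf T)

/-- Presheaves of modules over the sheaf of rings `R`. -/
abbrev ModPresheaf := PresheafOfModules.{u} (R.obj ⋙ forget₂ CommRingCat RingCat.{u})

/-- `R` as a sheaf of (not necessarily commutative) rings. -/
abbrev toRingCatSheaf : Sheaf (Opens.grothendieckTopology T) RingCat.{u} where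
  obj := R.obj ⋙ forget₂ CommRingCat RingCat.{u}
  property := ((sheafCompose _ (forget₂ CommRingCat RingCat.{u})).obj R).property

/-- Sheaves of modules over the sheaf of rings `R`. -/
abbrev ModSheaf := SheafOfModules.{u} (toRingCatSheaf R)

/-- The sheaf of modules associated with a presheaf of modules. -/
noncomputable def sheafify : ModPresheaf R ⥤ ModSheaf R :=
  PresheafOfModules.sheafification (R := toRingCatSheaf R) (𝟙 (toRingCatSheaf R).obj)

/-- The tensor product of two sheaves of modules: the sheaf associated with
`U ↦ M(U) ⊗ N(U)` (the tensor product over `R(U)`). -/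
noncomputable def tensor (M N : ModSheaf R) : ModSheaf R :=
  (sheafify R).obj (M.val ⊗ N.val)

variable {R}
/-- The restriction map `M(U) → M(V)` for `V ⊆ U`. -/
noncomputable def res (M : ModPresheaf R) {V U : Opens T} (i : V ⟶ U) :
    M.obj (op U) →+ M.obj (op V) := (M.presheaf.map i.op).hom

lemma res_smul (M : ModPresheaf R) {V U : Opens T} (i : V ⟶ U) (r : R.obj.obj (op U))
    (m : M.obj (op U)) : res M i (r • m) = (R.obj.map i.op).hom r • res M i m :=
  M.map_smul i.op r m

lemma res_res (M : ModPresheaf R) {W V U : Opens T} (j : W ⟶ V) (i : V ⟶ U) (k : W ⟶ U)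
    (m : M.obj (op U)) : res M j (res M i m) = res M k m :=
  (M.map_comp_apply i.op j.op m).symm

lemma app_res {M N : ModPresheaf R} (f : M ⟶ N) {V U : Opens T} (i : V ⟶ U)
    (m : M.obj (op U)) : f.app (op V) (res M i m) = res N i (f.app (op U) m) :=
  PresheafOfModules.naturality_apply f i.op m

/-- Locally bijective morphisms of presheaves of modules. -/
structure IsLocBij {P Q : ModPresheaf R} (f : P ⟶ Q) : Prop where
  inj : ∀ (U : Opens T) (m : P.obj (op U)), f.app (op U) m = 0 →
    ∀ x ∈ U, ∃ (V : Opens T) (i : V ⟶ U), x ∈ V ∧ res P i m = 0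
  surj : ∀ (U : Opens T) (n : Q.obj (op U)), ∀ x ∈ U, ∃ (V : Opens T) (i : V ⟶ U), x ∈ V ∧
    ∃ m : P.obj (op V), f.app (op V) m = res Q i n

lemma isLocBij_iff {P Q : ModPresheaf R} (f : P ⟶ Q) :
    IsLocBij f ↔ (Opens.grothendieckTopology T).W ((PresheafOfModules.toPresheaf _).map f) := by
  rw [GrothendieckTopology.W_iff_isLocallyBijective]
  constructor
  · intro h
    refine ⟨⟨fun {U} a b hab x hx => ?_⟩, ⟨fun {U} n x hx => ?_⟩⟩
    · obtain ⟨V, i, hxV, hV⟩ := h.inj U.unop (a - b : P.obj U)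
        ((map_sub (f.app U).hom a b).trans (sub_eq_zero.2 hab)) x hx
      refine ⟨V, i, ?_, hxV⟩
      exact sub_eq_zero.1 ((map_sub (P.map i.op).hom a b).symm.trans hV)
    · obtain ⟨V, i, hxV, m, hm⟩ := h.surj U n x hx
      exact ⟨V, i, ⟨m, hm⟩, hxV⟩
  · rintro ⟨h1, h2⟩
    refine ⟨fun U m hm x hx => ?_, fun U n x hx => ?_⟩
    · obtain ⟨V, i, hi, hxV⟩ := h1.equalizerSieve_mem (X := op U) m 0
        (hm.trans (map_zero (f.app (op U)).hom).symm) x hx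
      refine ⟨V, i, hxV, ?_⟩
      exact hi.trans (map_zero (P.presheaf.map i.op).hom)
    · obtain ⟨V, i, ⟨m, hm⟩, hxV⟩ := h2.imageSieve_mem (U := U) n x hx
      exact ⟨V, i, hxV, m, hm⟩

lemma IsLocBij.isIso_sheafify {P Q : ModPresheaf R} {f : P ⟶ Q} (h : IsLocBij f) :
    IsIso ((sheafify R).map f) := by
  rw [isLocBij_iff] at h
  have := PresheafOfModules.inverseImage_W_toPresheaf_eq_inverseImage_isomorphisms
    (R := toRingCatSheaf R) (𝟙 (toRingCatSheaf R).obj)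
  have hinv : ((Opens.grothendieckTopology T).W.inverseImage
      (PresheafOfModules.toPresheaf (toRingCatSheaf R).obj)) f := h
  rw [this] at hinv
  exact hinv

/-- The canonical morphism from a presheaf of modules to its associated sheaf. -/
noncomputable def toSheafify (P : ModPresheaf R) : P ⟶ ((sheafify R).obj P).val :=
  (PresheafOfModules.sheafificationHomEquiv (R := toRingCatSheaf R) (𝟙 (toRingCatSheaf R).obj)) (𝟙 ((sheafify R).obj P))

lemma isLocBij_toSheafify (P : ModPresheaf R) : IsLocBij (toSheafify P) := by
  rw [isLocBij_iff]
  exact GrothendieckTopology.W_toSheafify _ P.presheaf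


/-- The sheaf associated with a sheaf is the sheaf itself. -/
noncomputable def sheafifyIso (M : ModSheaf R) : (sheafify R).obj M.val ≅ M :=
  (asIso (PresheafOfModules.sheafificationAdjunction
    (R := toRingCatSheaf R) (𝟙 (toRingCatSheaf R).obj)).counit).app M

open TensorProduct in
/-- The section `m ⊗ n` of the presheaf tensor product. -/
noncomputable def pureTensor {M N : ModPresheaf R} {U : Opens T} (m : M.obj (op U)) (n : N.obj (op U)) :
    (M ⊗ N).obj (op U) := (m ⊗ₜ[R.obj.obj (op U)] n : M.obj (op U) ⊗[R.obj.obj (op U)] N.obj (op U))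

lemma res_pureTensor {M N : ModPresheaf R} {V U : Opens T} (i : V ⟶ U) (m : M.obj (op U)) (n : N.obj (op U)) :
    res (M ⊗ N) i (pureTensor m n) = pureTensor (res M i m) (res N i n) := rfl

lemma tensorHom_pureTensor {M N P Q : ModPresheaf R} (f : M ⟶ P) (g : N ⟶ Q) {U : Opens T}
    (m : M.obj (op U)) (n : N.obj (op U)) :
    (f ⊗ₘ g).app (op U) (pureTensor m n) = pureTensor (f.app (op U) m) (g.app (op U) n) := rfl

lemma whiskerRight_pureTensor {M P : ModPresheaf R} (f : M ⟶ P) (N : ModPresheaf R) {U : Opens T}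
    (m : M.obj (op U)) (n : N.obj (op U)) :
    (f ▷ N).app (op U) (pureTensor m n) = pureTensor (f.app (op U) m) n := rfl

open TensorProduct in
lemma free_tensor {A M N : Type*} [CommRing A] [AddCommGroup M] [AddCommGroup N] [Module A M]
    [Module A N] {e : N} (he : Function.Bijective fun r : A => r • e) :
    Function.Bijective fun m : M => m ⊗ₜ[A] e := by
  let E : A ≃ₗ[A] N := LinearEquiv.ofBijective (LinearMap.toSpanSingleton A N e) he
  have : (fun m : M => m ⊗ₜ[A] e) =
      ((TensorProduct.rid A M).symm ≪≫ₗ (TensorProduct.congr (LinearEquiv.refl A M) E)) := by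
    ext m
    have : E 1 = e := one_smul A e
    simp [this]
  rw [this]
  exact LinearEquiv.bijective _

/-- The section `s ∈ M(U)` is a basis of `M` over `U`: for each open `V ⊆ U`, the map
`R(V) → M(V)`, `r ↦ r • s|_V` is bijective. In other words, `s` defines an isomorphism from
`R|_U` to `M|_U`. -/
def IsGen (M : ModPresheaf R) {U : Opens T} (s : M.obj (op U)) : Prop :=
  ∀ (V : Opens T) (i : V ⟶ U), Function.Bijective fun r : R.obj.obj (op V) => r • res M i s

lemma IsGen.restrict {M : ModPresheaf R} {V U : Opens T} {s : M.obj (op U)} (h : IsGen M s)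
    (i : V ⟶ U) : IsGen M (res M i s) := by
  intro W j
  simpa only [res_res M j i (j ≫ i)] using h W (j ≫ i)

lemma IsGen.bij {M : ModPresheaf R} {U : Opens T} {s : M.obj (op U)} (h : IsGen M s) :
    Function.Bijective fun r : R.obj.obj (op U) => r • s := by
  have := h U (𝟙 U)
  have e : res M (𝟙 U) s = s := congr($(M.presheaf.map_id (op U)) s)
  rwa [e] at this

/-- `M` is locally free of rank one: each point has an open neighbourhood `U` such that `M|_U`
is isomorphic to `R|_U`. -/
def LocallyFreeRankOne (M : ModPresheaf R) : Prop :=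
  ∀ x : T, ∃ U : Opens T, x ∈ U ∧ ∃ s : M.obj (op U), IsGen M s

lemma pureTensor_bij {M N : ModPresheaf R} {U : Opens T} {s : N.obj (op U)} (h : IsGen N s) :
    Function.Bijective fun m : M.obj (op U) => (pureTensor m s : (M ⊗ N).obj (op U)) :=
  free_tensor h.bij

lemma LocallyFreeRankOne.whiskerRight {P Q : ModPresheaf R} {f : P ⟶ Q} (hf : IsLocBij f) {N : ModPresheaf R}
    (hN : LocallyFreeRankOne N) : IsLocBij (f ▷ N) := by
  refine ⟨fun U z hz x hx => ?_, fun U z x hx => ?_⟩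
  · obtain ⟨W, hxW, s, hs⟩ := hN x
    have hs' := hs.restrict (homOfLE (inf_le_right : U ⊓ W ≤ W))
    obtain ⟨m, hm⟩ := (pureTensor_bij (M := P) hs').2 (res _ (homOfLE inf_le_left) z)
    dsimp only at hm
    have h0 : f.app _ m = 0 := by
      apply (pureTensor_bij (M := Q) hs').1
      dsimp only
      rw [← whiskerRight_pureTensor, hm, app_res, hz, map_zero]
      exact (TensorProduct.zero_tmul _ _).symm
    obtain ⟨V, i, hxV, hV⟩ := hf.inj _ m h0 x ⟨hx, hxW⟩
    refine ⟨V, i ≫ homOfLE inf_le_left, hxV, ?_⟩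
    rw [← res_res _ i (homOfLE inf_le_left), ← hm, res_pureTensor]
    rw [hV]
    exact TensorProduct.zero_tmul _ _
  · obtain ⟨W, hxW, s, hs⟩ := hN x
    have hs' := hs.restrict (homOfLE (inf_le_right : U ⊓ W ≤ W))
    obtain ⟨n, hn⟩ := (pureTensor_bij (M := Q) hs').2 (res _ (homOfLE inf_le_left) z)
    dsimp only at hn
    obtain ⟨V, i, hxV, m, hm⟩ := hf.surj _ n x ⟨hx, hxW⟩
    refine ⟨V, i ≫ homOfLE inf_le_left, hxV, pureTensor m (res N i (res N (homOfLE inf_le_right) s)), ?_⟩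
    rw [← res_res _ i (homOfLE inf_le_left), ← hn, res_pureTensor, whiskerRight_pureTensor]
    exact congr_arg (fun t => pureTensor t _) hm

lemma IsGen.tmul {M N : ModPresheaf R} {U : Opens T} {s : M.obj (op U)} {t : N.obj (op U)}
    (hs : IsGen M s) (ht : IsGen N t) : IsGen (M ⊗ N) (pureTensor s t) := by
  intro V i
  exact (pureTensor_bij (M := M) (ht.restrict i)).comp (hs V i)

lemma LocallyFreeRankOne.tensor {M N : ModPresheaf R} (hM : LocallyFreeRankOne M) (hN : LocallyFreeRankOne N) : LocallyFreeRankOne (M ⊗ N) := by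
  intro x
  obtain ⟨U, hxU, s, hs⟩ := hM x
  obtain ⟨V, hxV, t, ht⟩ := hN x
  exact ⟨U ⊓ V, ⟨hxU, hxV⟩, _, (hs.restrict (homOfLE inf_le_left)).tmul (ht.restrict (homOfLE inf_le_right))⟩

lemma IsGen.of_isLocBij {P : ModPresheaf R} {M : ModSheaf R} {f : P ⟶ M.val} (hf : IsLocBij f)
    {U : Opens T} {s : P.obj (op U)} (hs : IsGen P s) : IsGen M.val (f.app (op U) s) := by
  have key : ∀ (V : Opens T) (i : V ⟶ U) (r : R.obj.obj (op V)),
      r • res M.val i (f.app (op U) s) = f.app (op V) (r • res P i s) := fun V i r => by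
    rw [← app_res]; exact ((f.app (op V)).hom.map_smul r _).symm
  have inj : ∀ (V : Opens T) (i : V ⟶ U),
      Function.Injective fun r : R.obj.obj (op V) => r • res M.val i (f.app (op U) s) := by
    intro V i r r' h
    dsimp only at h
    rw [key, key, ← sub_eq_zero] at h
    choose W j hxW hW using fun x : V => hf.inj V _ ((map_sub _ _ _).trans h) x.1 x.2
    have hR : TopCat.Presheaf.IsSheaf R.obj := R.property
    refine TopCat.Sheaf.eq_of_locally_eq' ⟨R.obj, hR⟩ W V j
      (fun x hx => Opens.mem_iSup.2 ⟨⟨x, hx⟩, hxW ⟨x, hx⟩⟩) r r' fun x => ?_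
    have h2 : res P (j x) (r • res P i s - r' • res P i s) = 0 := hW x
    rw [map_sub, res_smul, res_smul, sub_eq_zero, res_res P (j x) i (j x ≫ i)] at h2
    exact (hs _ _).1 h2
  refine fun V i => ⟨inj V i, fun y => ?_⟩
  choose W j hxW m hm using fun x : V => hf.surj V y x.1 x.2
  choose r hr using fun x : V => (hs _ (j x ≫ i)).2 (m x)
  have hR : TopCat.Presheaf.IsSheaf R.obj := R.property
  have hgen : ∀ (x : V) (Z : Opens T) (k : Z ⟶ W x) (l : Z ⟶ V),
      (R.obj.map k.op).hom (r x) • res M.val (l ≫ i) (f.app (op U) s) = res M.val l y := by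
    intro x Z k l
    rw [key, ← res_res P k (j x ≫ i) (l ≫ i), ← res_smul]
    have := hr x
    dsimp only at this
    rw [this, app_res, hm x]
    exact res_res _ k (j x) l y
  obtain ⟨r0, h0, -⟩ := TopCat.Sheaf.existsUnique_gluing' ⟨R.obj, hR⟩ W V j
      (fun x hx => Opens.mem_iSup.2 ⟨⟨x, hx⟩, hxW ⟨x, hx⟩⟩) r (fun a b => by
        apply inj _ ((Opens.infLELeft _ _ ≫ j a) ≫ i)
        exact (hgen a _ (Opens.infLELeft _ _) _).trans (hgen b _ (Opens.infLERight _ _) _).symm)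
  refine ⟨r0, ?_⟩
  refine TopCat.Sheaf.eq_of_locally_eq' ⟨M.val.presheaf, M.isSheaf⟩ W V j
      (fun x hx => Opens.mem_iSup.2 ⟨⟨x, hx⟩, hxW ⟨x, hx⟩⟩) _ _ fun x => ?_
  change res M.val (j x) (r0 • res M.val i (f.app (op U) s)) = res M.val (j x) y
  rw [res_smul, res_res M.val (j x) i (j x ≫ i), ← hgen x _ (𝟙 _) (j x)]
  congr 1
  refine (h0 x).trans ?_
  exact congr($(R.obj.map_id (op (W x))) (r x)).symm

lemma LocallyFreeRankOne.of_isLocBij {P : ModPresheaf R} {M : ModSheaf R} {f : P ⟶ M.val} (hf : IsLocBij f)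
    (h : LocallyFreeRankOne P) : LocallyFreeRankOne M.val := fun x => by
  obtain ⟨U, hxU, s, hs⟩ := h x
  exact ⟨U, hxU, _, hs.of_isLocBij hf⟩

lemma IsLocBij.of_isGen {P Q : ModPresheaf R} (f : P ⟶ Q)
    (h : ∀ x : T, ∃ U : Opens T, x ∈ U ∧ ∃ s : P.obj (op U), IsGen P s ∧
      IsGen Q (f.app (op U) s)) : IsLocBij f := by
  have key : ∀ {U V : Opens T} (s : P.obj (op U)) (i : V ⟶ U) (r : R.obj.obj (op V)),
      f.app (op V) (r • res P i s) = r • res Q i (f.app (op U) s) := fun s i r => by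
    rw [← app_res]; exact (f.app _).hom.map_smul r _
  refine ⟨fun U m hm x hx => ?_, fun U n x hx => ?_⟩
  all_goals
    obtain ⟨W, hxW, s, hs, hs'⟩ := h x
    let j : U ⊓ W ⟶ U := homOfLE inf_le_left
    let k : U ⊓ W ⟶ W := homOfLE inf_le_right
  · obtain ⟨r, hr⟩ := (hs _ k).2 (res P j m)
    dsimp only at hr
    have : r = 0 := (hs' _ k).1 (by
      dsimp only
      rw [← key, hr, app_res, hm, map_zero, zero_smul])
    exact ⟨_, j, ⟨hx, hxW⟩, by rw [← hr, this, zero_smul]⟩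
  · obtain ⟨r, hr⟩ := (hs' _ k).2 (res Q j n)
    exact ⟨_, j, ⟨hx, hxW⟩, r • res P k s, by rw [key]; exact hr⟩

/-- Families of maps `L(V) → R(V)`, for all open `V ⊆ U`. -/
def FunctionFamily (L : ModPresheaf R) (U : (Opens T)ᵒᵖ) : Type u :=
  ∀ (V : Opens T) (_ : V ⟶ U.unop), L.obj (op V) → R.obj.obj (op V)

noncomputable instance (L : ModPresheaf R) (U : (Opens T)ᵒᵖ) : CommRing (FunctionFamily L U) :=
  inferInstanceAs (CommRing (∀ (V : Opens T) (_ : V ⟶ U.unop), L.obj (op V) → R.obj.obj (op V)))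

noncomputable instance (L : ModPresheaf R) (U : (Opens T)ᵒᵖ) : Module (R.obj.obj U) (FunctionFamily L U) where
  smul r φ := fun V i m => (R.obj.map i.op).hom r * φ V i m
  one_smul φ := by
    funext V i m; exact (congr_arg (· * φ V i m) (map_one (R.obj.map i.op).hom)).trans (one_mul _)
  mul_smul r r' φ := by
    funext V i m
    exact (congr_arg (· * φ V i m) (map_mul (R.obj.map i.op).hom r r')).trans (mul_assoc _ _ _)
  smul_zero r := by funext V i m; exact mul_zero _
  smul_add r φ ψ := by funext V i m; exact mul_add _ _ _
  add_smul r r' φ := by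
    funext V i m
    exact (congr_arg (· * φ V i m) (map_add (R.obj.map i.op).hom r r')).trans (add_mul _ _ _)
  zero_smul φ := by
    funext V i m
    exact (congr_arg (· * φ V i m) (map_zero (R.obj.map i.op).hom)).trans (zero_mul _)

/-- The families of linear maps `L(V) → R(V)`, for `V ⊆ U`, that are compatible with
restrictions, i.e. the homomorphisms from `L|_U` to `R|_U`. -/
def dualSec (L : ModPresheaf R) (U : (Opens T)ᵒᵖ) : Submodule (R.obj.obj U) (FunctionFamily L U) where
  carrier := {φ | (∀ V i (m m' : L.obj (op V)), φ V i (m + m') = φ V i m + φ V i m') ∧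
    (∀ V i (r : R.obj.obj (op V)) (m : L.obj (op V)), φ V i (r • m) = r * φ V i m) ∧
    ∀ (V W : Opens T) (i : V ⟶ U.unop) (j : W ⟶ V) (m : L.obj (op V)),
      φ W (j ≫ i) (res L j m) = (R.obj.map j.op).hom (φ V i m)}
  add_mem' := by
    rintro φ ψ ⟨h1, h2, h3⟩ ⟨h1', h2', h3'⟩
    refine ⟨fun V i m m' => ?_, fun V i r m => ?_, fun V W i j m => ?_⟩
    · change φ V i _ + ψ V i _ = (φ V i m + ψ V i m) + (φ V i m' + ψ V i m')
      rw [h1, h1']; ring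
    · change φ V i _ + ψ V i _ = r * (φ V i m + ψ V i m)
      rw [h2, h2']; ring
    · change φ W _ _ + ψ W _ _ = (R.obj.map j.op).hom (φ V i m + ψ V i m)
      rw [h3, h3', map_add]
  zero_mem' := ⟨fun V i m m' => (add_zero (0 : R.obj.obj (op V))).symm,
    fun V i r m => (mul_zero r).symm, fun V W i j m => (map_zero (R.obj.map j.op).hom).symm⟩
  smul_mem' := by
    rintro r φ ⟨h1, h2, h3⟩
    refine ⟨fun V i m m' => ?_, fun V i a m => ?_, fun V W i j m => ?_⟩
    · change (R.obj.map i.op).hom r * φ V i _ = (R.obj.map i.op).hom r * φ V i m + (R.obj.map i.op).hom r * φ V i m'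
      rw [h1]; ring
    · change (R.obj.map i.op).hom r * φ V i _ = a * ((R.obj.map i.op).hom r * φ V i m)
      rw [h2]; ring
    · change (R.obj.map (j ≫ i).op).hom r * φ W _ _ = (R.obj.map j.op).hom ((R.obj.map i.op).hom r * φ V i m)
      rw [h3, map_mul, op_comp, R.obj.map_comp]; rfl

/-- The abelian presheaf `U ↦ Hom(L|_U, R|_U)`. -/
noncomputable def dualPresheaf (L : ModPresheaf R) : (Opens T)ᵒᵖ ⥤ Ab.{u} where
  obj U := AddCommGrpCat.of (dualSec L U)
  map {U V} f := AddCommGrpCat.ofHom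
    { toFun := fun φ => ⟨fun W i => φ.1 W (i ≫ f.unop), fun W i => φ.2.1 W _,
        fun W i => φ.2.2.1 W _, fun W Z i j m => φ.2.2.2 W Z (i ≫ f.unop) j m⟩
      map_zero' := rfl
      map_add' := fun _ _ => rfl }

noncomputable instance (L : ModPresheaf R) (U : (Opens T)ᵒᵖ) :
    Module ((R.obj ⋙ forget₂ CommRingCat RingCat.{u}).obj U) ((dualPresheaf L).obj U) :=
  inferInstanceAs (Module (R.obj.obj U) (dualSec L U))

/-- The presheaf of modules `U ↦ Hom(L|_U, R|_U)`. -/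
noncomputable def dual (L : ModPresheaf R) : ModPresheaf R :=
  PresheafOfModules.ofPresheaf (dualPresheaf L) (fun U V f r φ => by
    apply Subtype.ext
    funext W i m
    change (R.obj.map (f.unop.op ≫ i.op)).hom r * _ = (R.obj.map i.op).hom ((R.obj.map f).hom r) * _
    rw [R.obj.map_comp]
    rfl)

/-- The evaluation `L ⊗ Hom(L, R) ⟶ R`. -/
noncomputable def dualPairing (L : ModPresheaf R) : L ⊗ dual L ⟶ 𝟙_ (ModPresheaf R) where
  app U := ModuleCat.MonoidalCategory.tensorLift (R := R.obj.obj U)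
    (fun (m : L.obj U) (φ : dualSec L U) => (φ.1 U.unop (𝟙 _) m : R.obj.obj U))
    (fun m m' φ => φ.2.1 _ _ m m') (fun a m φ => φ.2.2.1 _ _ a m)
    (fun m φ φ' => rfl) (fun a m φ => by
      change (R.obj.map (𝟙 U)).hom a * _ = a * _
      rw [R.obj.map_id]; rfl)
  naturality {U V} f := ModuleCat.MonoidalCategory.tensor_ext fun m φ => by
    exact φ.2.2.2 U.unop V.unop (𝟙 _) f.unop m

lemma dualPairing_pureTensor (L : ModPresheaf R) {U : Opens T} (m : L.obj (op U)) (φ : dualSec L (op U)) :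
    (dualPairing L).app (op U) (pureTensor m (N := dual L) φ) = φ.1 U (𝟙 _) m := rfl

/-- The coordinate of a section with respect to a basis. -/
noncomputable def coord {L : ModPresheaf R} {U V : Opens T} {s : L.obj (op U)} (hs : IsGen L s)
    (i : V ⟶ U) (m : L.obj (op V)) : R.obj.obj (op V) := ((hs V i).2 m).choose

lemma coord_spec {L : ModPresheaf R} {U V : Opens T} {s : L.obj (op U)} (hs : IsGen L s)
    (i : V ⟶ U) (m : L.obj (op V)) : coord hs i m • res L i s = m := ((hs V i).2 m).choose_spec

lemma coord_eq {L : ModPresheaf R} {U V : Opens T} {s : L.obj (op U)} (hs : IsGen L s)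
    (i : V ⟶ U) (m : L.obj (op V)) (r : R.obj.obj (op V)) (h : r • res L i s = m) :
    coord hs i m = r := (hs V i).1 ((coord_spec hs i m).trans h.symm)

/-- The dual basis. -/
noncomputable def dualGen {L : ModPresheaf R} {U : Opens T} {s : L.obj (op U)} (hs : IsGen L s) :
    dualSec L (op U) :=
  ⟨fun V i m => coord hs i m,
    fun V i m m' => coord_eq _ _ _ _ (by rw [add_smul, coord_spec, coord_spec]),
    fun V i r m => coord_eq _ _ _ _ (by rw [mul_smul, coord_spec]),
    fun V W i j m => coord_eq _ _ _ _ (by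
      rw [← res_res L j i (j ≫ i), ← res_smul, coord_spec])⟩

lemma isGen_dualGen {L : ModPresheaf R} {U : Opens T} {s : L.obj (op U)} (hs : IsGen L s) :
    IsGen (dual L) (dualGen hs : (dual L).obj (op U)) := by
  intro V i
  have key : ∀ (r : R.obj.obj (op V)) (W : Opens T) (j : W ⟶ V) (m : L.obj (op W)),
    (show dualSec L (op V) from r • res (dual L) i (dualGen hs : (dual L).obj (op U))).1 W j m =
      (R.obj.map j.op).hom r * coord hs (j ≫ i) m := fun r W j m => rfl
  refine ⟨fun r r' h => ?_, fun φ => ?_⟩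
  · have h1 := congr_arg (fun ψ : dualSec L (op V) => ψ.1 V (𝟙 V) (res L i s)) h
    dsimp only at h1
    have h2 : coord hs (𝟙 V ≫ i) (res L i s) = 1 := coord_eq _ _ _ _ (one_smul _ _)
    erw [key, key, h2, mul_one, mul_one, R.obj.map_id] at h1
    exact h1
  · refine ⟨(φ : dualSec L (op V)).1 V (𝟙 V) (res L i s), ?_⟩
    refine Subtype.ext ?_
    funext W j m
    refine (key _ W j m).trans ?_
    erw [← φ.2.2.2 V W (𝟙 V) j, res_res L j i (j ≫ i)]
    rw [mul_comm]
    erw [← φ.2.2.1]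
    rw [coord_spec]
    rfl

lemma LocallyFreeRankOne.dual {L : ModPresheaf R} (hL : LocallyFreeRankOne L) : LocallyFreeRankOne (dual L) := fun x => by
  obtain ⟨U, hxU, s, hs⟩ := hL x
  exact ⟨U, hxU, _, isGen_dualGen hs⟩

lemma isGen_one (U : Opens T) : IsGen (𝟙_ (ModPresheaf R)) (U := U) (1 : R.obj.obj (op U)) := by
  intro V i
  have : res (𝟙_ (ModPresheaf R)) i (1 : R.obj.obj (op U)) = (1 : R.obj.obj (op V)) :=
    map_one (R.obj.map i.op).hom
  rw [this]
  refine ⟨fun a b h => ?_, fun b => ⟨b, ?_⟩⟩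
  · exact (mul_one a).symm.trans (h.trans (mul_one b))
  · exact mul_one (show R.obj.obj (op V) from b)

lemma isLocBij_dualPairing {L : ModPresheaf R} (hL : LocallyFreeRankOne L) : IsLocBij (dualPairing L) := by
  refine .of_isGen _ fun x => ?_
  obtain ⟨U, hxU, s, hs⟩ := hL x
  refine ⟨U, hxU, pureTensor s (dualGen hs : (PicardLift.dual L).obj (op U)), hs.tmul (isGen_dualGen hs), ?_⟩
  have : (dualPairing L).app (op U) (pureTensor s (N := PicardLift.dual L) (dualGen hs)) = (1 : R.obj.obj (op U)) := by
    refine (dualPairing_pureTensor L s _).trans (coord_eq hs (𝟙 U) s 1 ?_)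
    rw [one_smul]; exact congr($(L.presheaf.map_id (op U)) s)
  rw [this]
  exact isGen_one U


variable (R) in
/-- Invertible sheaves: sheaves of modules that are locally free of rank one. -/
structure InvertibleSheaf where
  /-- the underlying sheaf of modules -/
  carrier : ModSheaf R
  locFree : LocallyFreeRankOne carrier.val

/-- The tensor product respects isomorphisms. -/
noncomputable def tensorIso {M M' N N' : ModSheaf R} (e : M ≅ M') (e₂ : N ≅ N') :
    tensor R M N ≅ tensor R M' N' :=
  (sheafify R).mapIso ((SheafOfModules.forget _).mapIso e ⊗ᵢ (SheafOfModules.forget _).mapIso e₂)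

/-- The tensor product is commutative. -/
noncomputable def tensorComm (M N : ModSheaf R) : tensor R M N ≅ tensor R N M :=
  (sheafify R).mapIso (β_ M.val N.val)

/-- `R` is a unit for the tensor product. -/
noncomputable def unitTensor (M : ModSheaf R) : tensor R (SheafOfModules.unit (toRingCatSheaf R)) M ≅ M :=
  (sheafify R).mapIso (λ_ M.val) ≪≫ sheafifyIso M

/-- Sheafifying the first factor does not change the sheaf associated with `P ⊗ K`. -/
noncomputable def sheafifyTensor (P : ModPresheaf R) (K : ModSheaf R) (hK : LocallyFreeRankOne K.val) :
    (sheafify R).obj (P ⊗ K.val) ≅ tensor R ((sheafify R).obj P) K :=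
  @asIso _ _ _ _ ((sheafify R).map (toSheafify P ▷ K.val))
    (LocallyFreeRankOne.whiskerRight (isLocBij_toSheafify P) hK).isIso_sheafify

/-- The tensor product is associative (here for locally free outer factors). -/
noncomputable def tensorAssoc (M N K : ModSheaf R) (hM : LocallyFreeRankOne M.val) (hK : LocallyFreeRankOne K.val) :
    tensor R (tensor R M N) K ≅ tensor R M (tensor R N K) :=
  (sheafifyTensor (M.val ⊗ N.val) K hK).symm ≪≫
    (sheafify R).mapIso (α_ M.val N.val K.val ≪≫ β_ _ _) ≪≫
      sheafifyTensor (N.val ⊗ K.val) M hM ≪≫ tensorComm _ _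

lemma LocallyFreeRankOne.tensorSheaf {M N : ModSheaf R} (hM : LocallyFreeRankOne M.val) (hN : LocallyFreeRankOne N.val) :
    LocallyFreeRankOne (PicardLift.tensor R M N).val :=
  (hM.tensor hN).of_isLocBij (isLocBij_toSheafify _)

lemma locallyFreeRankOne_unit : LocallyFreeRankOne (𝟙_ (ModPresheaf R)) := fun _ => ⟨⊤, trivial, _, isGen_one ⊤⟩

/-- The dual of a locally free sheaf of rank one is its inverse. -/
noncomputable def tensorDual (M : ModSheaf R) (hM : LocallyFreeRankOne M.val) :
    tensor R ((sheafify R).obj (dual M.val)) M ≅ SheafOfModules.unit (toRingCatSheaf R) :=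
  (sheafifyTensor (dual M.val) M hM).symm ≪≫ (sheafify R).mapIso (β_ _ _) ≪≫
    @asIso _ _ _ _ ((sheafify R).map (dualPairing M.val)) (isLocBij_dualPairing hM).isIso_sheafify ≪≫
      sheafifyIso (SheafOfModules.unit (toRingCatSheaf R))

variable (R) in
/-- Isomorphism of invertible sheaves. -/
instance invertibleSetoid : Setoid (InvertibleSheaf R) where
  r L M := Nonempty (L.carrier ≅ M.carrier)
  iseqv := ⟨fun _ => ⟨Iso.refl _⟩, fun ⟨e⟩ => ⟨e.symm⟩, fun ⟨e⟩ ⟨e₂⟩ => ⟨e ≪≫ e₂⟩⟩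

variable (R) in
/-- The Picard group: isomorphism classes of invertible sheaves. -/
def Pic : Type (u + 1) := _root_.Quotient (invertibleSetoid R)

/-- The isomorphism class of an invertible sheaf. -/
def Pic.mk (L : InvertibleSheaf R) : Pic R := _root_.Quotient.mk _ L

/-- The multiplication on `Pic` is the tensor product. -/
noncomputable instance : Mul (Pic R) where
  mul := _root_.Quotient.map₂ (fun L M => ⟨tensor R L.carrier M.carrier, L.locFree.tensorSheaf M.locFree⟩)
    fun _ _ ⟨e⟩ _ _ ⟨e₂⟩ => ⟨tensorIso e e₂⟩

/-- The neutral element of `Pic` is the structure sheaf. -/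
noncomputable instance : One (Pic R) where
  one := .mk ⟨SheafOfModules.unit (toRingCatSheaf R), locallyFreeRankOne_unit⟩

/-- The dual invertible sheaf. -/
noncomputable def InvertibleSheaf.dual (L : InvertibleSheaf R) : InvertibleSheaf R :=
  ⟨(sheafify R).obj (PicardLift.dual L.carrier.val),
    (LocallyFreeRankOne.dual L.locFree).of_isLocBij (isLocBij_toSheafify _)⟩

lemma Pic.mul_assoc' (a b c : Pic R) : a * b * c = a * (b * c) := by
  induction a using _root_.Quotient.inductionOn with | _ a
  induction b using _root_.Quotient.inductionOn with | _ b
  induction c using _root_.Quotient.inductionOn with | _ c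
  exact _root_.Quotient.sound ⟨tensorAssoc _ _ _ a.locFree c.locFree⟩

lemma Pic.mul_comm' (a b : Pic R) : a * b = b * a := by
  induction a using _root_.Quotient.inductionOn with | _ a
  induction b using _root_.Quotient.inductionOn with | _ b
  exact _root_.Quotient.sound ⟨tensorComm _ _⟩

lemma Pic.one_mul' (a : Pic R) : 1 * a = a := by
  induction a using _root_.Quotient.inductionOn with | _ a
  exact _root_.Quotient.sound ⟨unitTensor _⟩

lemma Pic.mk_dual_mul (L : InvertibleSheaf R) : Pic.mk L.dual * Pic.mk L = 1 :=
  _root_.Quotient.sound ⟨tensorDual _ L.locFree⟩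

lemma Pic.dual_congr {L M : InvertibleSheaf R} (h : L ≈ M) : Pic.mk L.dual = Pic.mk M.dual := by
  have h' : Pic.mk L = Pic.mk M := _root_.Quotient.sound h
  rw [← Pic.one_mul' (Pic.mk L.dual), ← Pic.mk_dual_mul M, Pic.mul_assoc', ← h',
    Pic.mul_comm' (Pic.mk L), Pic.mk_dual_mul, Pic.mul_comm', Pic.one_mul']

/-- The inverse in `Pic` is the dual. -/
noncomputable instance : CommGroup (Pic R) where
  mul_assoc := Pic.mul_assoc'
  one_mul := Pic.one_mul'
  mul_one a := by rw [Pic.mul_comm', Pic.one_mul']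
  mul_comm := Pic.mul_comm'
  inv := _root_.Quotient.lift (fun L => Pic.mk L.dual) fun _ _ h => Pic.dual_congr h
  inv_mul_cancel a := by
    induction a using _root_.Quotient.inductionOn with | _ a
    exact Pic.mk_dual_mul a


noncomputable section

/-- The structure sheaf of a ringed space. -/
abbrev structureSheaf (Z : RingedSpace.{u}) : RingSheaf Z.carrier := ⟨Z.presheaf, Z.IsSheaf⟩

/-- The morphism of sheaves of rings `O_W ⟶ g_* O_Z` of a morphism `g : Z ⟶ W`. -/
def ringMap {Z W : RingedSpace.{u}} (g : Z ⟶ W) :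
    toRingCatSheaf (structureSheaf W) ⟶ ((Opens.map g.hom.base).sheafPushforwardContinuous RingCat.{u}
      (Opens.grothendieckTopology W.carrier) (Opens.grothendieckTopology Z.carrier)).obj
        (toRingCatSheaf (structureSheaf Z)) where
  hom := Functor.whiskerRight g.hom.c (forget₂ CommRingCat RingCat.{u})

lemma pushforward_isRightAdjoint {T T' : TopCat.{u}} (g : T ⟶ T') (R : RingSheaf T) (S : RingSheaf T')
    (φ : toRingCatSheaf S ⟶ ((Opens.map g).sheafPushforwardContinuous RingCat.{u}
      (Opens.grothendieckTopology T') (Opens.grothendieckTopology T)).obj (toRingCatSheaf R)) :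
    (SheafOfModules.pushforward.{u} φ).IsRightAdjoint := by
  have aux (ψ : (toRingCatSheaf S).obj ⟶ (Opens.map g).op ⋙ (toRingCatSheaf R).obj) :
      (PresheafOfModules.pushforward.{u} ψ).IsRightAdjoint := inferInstance
  have : (PresheafOfModules.pushforward.{u} φ.hom).IsRightAdjoint := aux φ.hom
  exact (SheafOfModules.PullbackConstruction.adjunction.{u} φ).isRightAdjoint

/-- The inverse image functor `g^*` from `O_W`-modules to `O_Z`-modules, left adjoint to `g_*`. -/
def inverseImage {Z W : RingedSpace.{u}} (g : Z ⟶ W) :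
    ModSheaf (structureSheaf W) ⥤ ModSheaf (structureSheaf Z) :=
  have := pushforward_isRightAdjoint g.hom.base (structureSheaf Z) (structureSheaf W) (ringMap g)
  SheafOfModules.pullback.{u} (ringMap g)

/-- The structure sheaf as a sheaf of abelian groups. -/
abbrev structureSheafAb (Z : RingedSpace.{u}) : Sheaf (Opens.grothendieckTopology Z.carrier) AddCommGrpCat.{u} :=
  (sheafCompose _ (forget₂ CommRingCat RingCat.{u} ⋙ forget₂ RingCat AddCommGrpCat.{u})).obj
    (structureSheaf Z)

/-- The sheaf cohomology group `H^1(Z, O_Z)`. -/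
abbrev H1 (Z : RingedSpace.{u}) : Type u := Sheaf.H (structureSheafAb Z) 1

variable {p : ℕ} [Fact p.Prime] {X : Scheme.{0}} (f : X ⟶ Spec (.of ℤ_[p]))

/-- The closed immersion `Spec ℤ/p^n ⟶ Spec ℤ_p`. -/
def modPow (p : ℕ) [Fact p.Prime] (n : ℕ) : Spec (.of (ZMod (p ^ n))) ⟶ Spec (.of ℤ_[p]) :=
  Spec.map (CommRingCat.ofHom (PadicInt.toZModPow n))

/-- `X_{p^n}`, the fibre product of `X` and `Spec ℤ/p^n` over `Spec ℤ_p`. -/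
abbrev thickening (n : ℕ) : Scheme.{0} := Limits.pullback f (modPow p n)

/-- The projection `X_{p^n} ⟶ X`. -/
abbrev thickeningι (n : ℕ) : thickening f n ⟶ X := Limits.pullback.fst f (modPow p n)

lemma modPow_factor {m n : ℕ} (h : m ≤ n) :
    Spec.map (CommRingCat.ofHom (ZMod.castHom (pow_dvd_pow p h) (ZMod (p ^ m)))) ≫ modPow p n =
      modPow p m := by
  rw [modPow, modPow, ← Spec.map_comp, ← CommRingCat.ofHom_comp,
      PadicInt.zmod_cast_comp_toZModPow _ _ h]

/-- The canonical morphism `X_{p^m} ⟶ X_{p^n}` for `m ≤ n`. -/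
def transition {m n : ℕ} (h : m ≤ n) : thickening f m ⟶ thickening f n :=
  Limits.pullback.lift (Limits.pullback.fst f (modPow p m))
    (Limits.pullback.snd f (modPow p m) ≫
      Spec.map (CommRingCat.ofHom (ZMod.castHom (pow_dvd_pow p h) (ZMod (p ^ m))))) (by
    rw [Category.assoc, modPow_factor h]
    exact Limits.pullback.condition)

lemma transition_ι {m n : ℕ} (h : m ≤ n) :
    transition f h ≫ thickeningι f n = thickeningι f m := Limits.pullback.lift_fst _ _ _

instance (n : ℕ) : IsClosedImmersion (modPow p n) :=
  IsClosedImmersion.spec_of_surjective _ (ZMod.ringHom_surjective _)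

instance {m n : ℕ} (h : m ≤ n) : IsClosedImmersion (transition f h) :=
  have : IsClosedImmersion (transition f h ≫ thickeningι f n) := by
    rw [transition_ι]; infer_instance
  .of_comp (transition f h) (thickeningι f n)

lemma range_modPow {n : ℕ} (hn : n ≠ 0) :
    Set.range (modPow p n) = PrimeSpectrum.zeroLocus {(p : ℤ_[p])} := by
  refine (range_comap_of_surjective _ (PadicInt.toZModPow (p := p) n)
    (ZMod.ringHom_surjective _)).trans ?_
  rw [PadicInt.ker_toZModPow, PrimeSpectrum.zeroLocus_span,
    PrimeSpectrum.zeroLocus_singleton_pow _ _ (Nat.pos_of_ne_zero hn)]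

lemma transition_surjective {m n : ℕ} (hm : m ≠ 0) (h : m ≤ n) :
    Function.Surjective (transition f h) := by
  intro x
  have hx : thickeningι f n x ∈ Set.range (thickeningι f n) := ⟨x, rfl⟩
  have hr : Set.range (thickeningι f n) = Set.range (thickeningι f m) := by
    refine (Scheme.Pullback.range_fst f (modPow p n)).trans
      (.trans ?_ (Scheme.Pullback.range_fst f (modPow p m)).symm)
    rw [range_modPow hm, range_modPow (by omega)]
  rw [hr] at hx
  obtain ⟨y, hy⟩ := hx
  refine ⟨y, (thickeningι f n).isClosedEmbedding.injective ?_⟩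
  rw [← hy, ← transition_ι f h]
  rfl

/-- The closed immersion `X_p ⟶ X_{p^{n+1}}` is a homeomorphism. -/
def specialFiberHomeo (n : ℕ) : thickening f 1 ≃ₜ thickening f (n + 1) :=
  ((transition f (Nat.le_add_left 1 n)).isClosedEmbedding.isEmbedding).toHomeomorphOfSurjective
    (transition_surjective f one_ne_zero _)

/-- The continuous map `X_{p^{n+1}} ⟶ X_p` inverse to the canonical homeomorphism. -/
def retraction (n : ℕ) :
    (thickening f (n + 1)).toPresheafedSpace.carrier ⟶ (thickening f 1).toPresheafedSpace.carrier :=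
  TopCat.ofHom ⟨(specialFiberHomeo f n).symm, (specialFiberHomeo f n).symm.continuous⟩

lemma retraction_transition (n : ℕ) (x : thickening f (n + 1)) :
    retraction f (n + 1) (transition f (Nat.le_succ (n + 1)) x) = retraction f n x := by
  obtain ⟨y, rfl⟩ := (specialFiberHomeo f n).surjective x
  have h1 : retraction f n (specialFiberHomeo f n y) = y := (specialFiberHomeo f n).symm_apply_apply y
  have h2 : transition f (Nat.le_succ (n + 1)) (specialFiberHomeo f n y) = specialFiberHomeo f (n + 1) y := by
    apply (thickeningι f (n + 2)).isClosedEmbedding.injective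
    change (transition f _ ≫ transition f _ ≫ thickeningι f (n + 2)) y =
      (transition f _ ≫ thickeningι f (n + 2)) y
    rw [transition_ι, transition_ι, transition_ι]
  rw [h1, h2]
  exact (specialFiberHomeo f (n + 1)).symm_apply_apply y

/-- The structure sheaf of `X_{p^{n+1}}`, as a sheaf on the space underlying `X_p`. -/
def levelSheaf (n : ℕ) : RingSheaf (thickening f 1).toPresheafedSpace.carrier :=
  ⟨(Opens.map (retraction f n)).op ⋙ (thickening f (n + 1)).presheaf,
    TopCat.Sheaf.pushforward_sheaf_of_sheaf (retraction f n) (thickening f (n + 1)).IsSheaf⟩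

/-- The restriction of functions from `X_{p^{n+2}}` to `X_{p^{n+1}}`. -/
def levelMap (n : ℕ) : levelSheaf f (n + 1) ⟶ levelSheaf f n where
  hom :=
    { app := fun U => (transition f (Nat.le_succ (n + 1))).appLE
        ((Opens.map (retraction f (n + 1))).obj U.unop) ((Opens.map (retraction f n)).obj U.unop)
        (fun x hx => by
          change retraction f (n + 1) (transition f (Nat.le_succ (n + 1)) x) ∈ U.unop
          rw [retraction_transition]
          exact hx)
      naturality := fun U V i =>
        (Scheme.Hom.map_appLE _ _ _).trans (Scheme.Hom.appLE_map _ _ _).symm }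

/-- The sheaf of rings `lim_n O_{X_{p^n}}` on the space underlying `X_p`. -/
def completedSheaf : RingSheaf (thickening f 1).toPresheafedSpace.carrier :=
  Limits.limit (Functor.ofOpSequence (levelMap f))

/-- The formal completion of `X` along `(p)`, as a ringed space. The topology on the structure
sheaf is not recorded: it plays no role for invertible sheaves. -/
def formalCompletion : RingedSpace.{0} where
  carrier := (thickening f 1).toPresheafedSpace.carrier
  presheaf := (completedSheaf f).obj
  IsSheaf := (completedSheaf f).property

/-- The special fibre `X_p`, as a ringed space. -/
abbrev specialFiber : RingedSpace.{0} := (thickening f 1).toSheafedSpace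

/-- The canonical morphism from the special fibre to the formal completion: the identity on the
underlying spaces, and the projection from `lim_n O_{X_{p^n}}` to `O_{X_p}`. -/
def specialFiberInclusion : specialFiber f ⟶ formalCompletion f where
  hom :=
    { base := 𝟙 (thickening f 1).toPresheafedSpace.carrier
      c := (Limits.limit.π (Functor.ofOpSequence (levelMap f)) (op 0)).hom ≫
        { app := fun U => (transition f le_rfl).appLE
            ((Opens.map (retraction f 0)).obj U.unop) U.unop (fun x hx => by
              change retraction f 0 (specialFiberHomeo f 0 x) ∈ U.unop
              rw [show retraction f 0 (specialFiberHomeo f 0 x) = x from (specialFiberHomeo f 0).symm_apply_apply x]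
              exact hx)
          naturality := fun U V i =>
            (Scheme.Hom.map_appLE _ _ _).trans (Scheme.Hom.appLE_map _ _ _).symm } }

/-- The classes in `Pic(X_p)` of the invertible sheaves that lift, i.e. that are isomorphic to the
restriction of an invertible sheaf on the formal completion. -/
def liftable : Set (Pic (structureSheaf (specialFiber f))) :=
  {a | ∃ (L : InvertibleSheaf (structureSheaf (specialFiber f)))
    (M : InvertibleSheaf (structureSheaf (formalCompletion f))),
      Pic.mk L = a ∧ Nonempty ((inverseImage (specialFiberInclusion f)).obj M.carrier ≅ L.carrier)}

end

end PicardLift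

/-!
Write `Ô` for the structure sheaf of the formal completion, so that `O_{X_p} = Ô / p`. An
invertible sheaf is given by a Čech cocycle of units, tensor products correspond to products of
cocycles, and an inverse image is given by the image of the cocycle
(`IsTriv.nonempty_inverseImage_iso`). Hence a class in `Pic(X_p)` lifts if and only if it is
represented by a cocycle of `O_{X_p}` that lifts to a cocycle of `Ô` (`IsLiftable.of_hasCocycle`,
`IsLiftable.exists_hasCocycle`), and the liftable classes form a subgroup. It remains to show that
`a` lifts if `a ^ l` does, for a prime number `l`.

Let `W` be an affine open subset of `X`. Since `X` is flat over `ℤ_p`, the ring `Ô(W ∩ X_p)` is the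
limit of the rings `B / p ^ n` for a `p`-torsion-free ring `B`, so it is `p`-torsion-free with
reduction `O_{X_p}(W ∩ X_p)` modulo `p`, and equations `a x + p h(x) = y` with `a` a unit have
unique solutions (`isCompleteReduction_comorphism`). From the binomial expansion one deduces, `p`
being odd, that the `p`-th power is a bijection from `1 + p Ô` to `1 + p² Ô`, and that the `l`-th
power is bijective on `1 + p Ô` for the other primes `l`. As `X` is separated, the affine open sets
are stable under intersections, and these facts apply to all the sets involved in a Čech cocycle.

Let `q` be a cocycle of `a`, and let `m` be a cocycle of `Ô` that reduces to `q ^ l`. Choose units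
`e i j` of `Ô` lifting the `q i j`; then `m i j = (e i j) ^ l (1 + p y i j)`. If `1 + p y i j` has
an `l`-th root in `1 + p Ô`, then multiplying `e i j` by it gives a lifting of `q i j` whose `l`-th
power is `m i j`. Such liftings form a cocycle, because `1 + p Ô` has no `l`-torsion
(`isCocycle_of_pow_eq`). For `l ≠ p` the root exists. For `l = p`, two liftings of the same unit
have the same `p`-th power modulo `p²`, so the `y i j` modulo `p` form an additive cocycle of
`O_{X_p}`. As `H^1(X_p, O_{X_p}) = 0`, it is a coboundary, the difference of some `b i` and `b j`
(`exists_additive_coboundary`). Multiplying `m` by the coboundary of the units `1 + p β i`, where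
`β i` lifts `b i`, one may replace the `1 + p y i j` by elements of `1 + p² Ô`, which have `p`-th
roots (`exists_lift_of_pow_lift`). In this way `q` itself is lifted to a cocycle, and no obstruction
in `H^2` has to be considered.

That `H^1 = 0`, for cohomology defined by `Ext` groups, makes additive Čech cocycles coboundaries is
seen by embedding the sheaf into the sheaf of its discontinuous sections, in which the cocycle has
an explicit splitting.
-/

namespace PicardLift
noncomputable section

/-! ### Cocycles with values in the units of a sheaf of rings -/

section Cocycles

variable {T : TopCat.{u}}

/-- The restriction homomorphism `R(U) → R(V)` for `V ≤ U`. -/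
def ringRes (R : RingSheaf T) {V U : Opens T} (h : V ≤ U) :
    R.obj.obj (op U) →+* R.obj.obj (op V) := (R.obj.map (homOfLE h).op).hom

/-- The restriction map `M(U) → M(V)` for `V ≤ U`. -/
def modRes {R : RingSheaf T} (M : ModPresheaf R) {V U : Opens T} (h : V ≤ U) :
    M.obj (op U) →+ M.obj (op V) := res M (homOfLE h)

variable {R : RingSheaf T}

@[simp] lemma ringRes_ringRes {W V U : Opens T} (h : W ≤ V) (h' : V ≤ U) (r : R.obj.obj (op U)) :
    ringRes R h (ringRes R h' r) = ringRes R (h.trans h') r :=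
  congr($(R.obj.map_comp (homOfLE h').op (homOfLE h).op) r).symm

@[simp] lemma ringRes_self {U : Opens T} (h : U ≤ U) (r : R.obj.obj (op U)) :
    ringRes R h r = r :=
  congr($(R.obj.map_id (op U)) r)

@[simp] lemma modRes_modRes (M : ModPresheaf R) {W V U : Opens T} (h : W ≤ V) (h' : V ≤ U)
    (m : M.obj (op U)) : modRes M h (modRes M h' m) = modRes M (h.trans h') m :=
  res_res M _ _ _ m

@[simp] lemma modRes_self (M : ModPresheaf R) {U : Opens T} (h : U ≤ U) (m : M.obj (op U)) :
    modRes M h m = m :=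
  congr($(M.presheaf.map_id (op U)) m)

lemma modRes_smul (M : ModPresheaf R) {V U : Opens T} (h : V ≤ U) (r : R.obj.obj (op U))
    (m : M.obj (op U)) : modRes M h (r • m) = ringRes R h r • modRes M h m :=
  res_smul M _ r m

lemma app_modRes {M N : ModPresheaf R} (f : M ⟶ N) {V U : Opens T} (h : V ≤ U)
    (m : M.obj (op U)) : f.app (op V) (modRes M h m) = modRes N h (f.app (op U) m) :=
  app_res f _ m

lemma app_smul {M N : ModPresheaf R} (f : M ⟶ N) {U : Opens T} (r : R.obj.obj (op U))
    (m : M.obj (op U)) : f.app (op U) (r • m) = r • f.app (op U) m :=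
  (f.app (op U)).hom.map_smul r m

lemma IsGen.modRes_bijective {M : ModPresheaf R} {U : Opens T} {s : M.obj (op U)}
    (hs : IsGen M s) {V : Opens T} (h : V ≤ U) :
    Function.Bijective fun r : R.obj.obj (op V) => r • modRes M h s :=
  hs V (homOfLE h)

lemma modSheaf_eq_of_locally_eq (G : ModSheaf R) {ι : Type*} {V : Opens T} (W : ι → Opens T)
    (hW : ∀ i, W i ≤ V) (hcover : ∀ x ∈ V, ∃ i, x ∈ W i) {a b : G.val.obj (op V)}
    (h : ∀ i, modRes G.val (hW i) a = modRes G.val (hW i) b) : a = b :=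
  TopCat.Sheaf.eq_of_locally_eq' ⟨G.val.presheaf, G.isSheaf⟩ W V (fun i => homOfLE (hW i))
    (fun x hx => Opens.mem_iSup.2 (hcover x hx)) a b h

lemma modSheaf_exists_glue (G : ModSheaf R) {ι : Type*} {V : Opens T} (W : ι → Opens T)
    (hW : ∀ i, W i ≤ V) (hcover : ∀ x ∈ V, ∃ i, x ∈ W i) (a : ∀ i, G.val.obj (op (W i)))
    (h : ∀ i j, modRes G.val (inf_le_left : W i ⊓ W j ≤ W i) (a i) =
      modRes G.val (inf_le_right : W i ⊓ W j ≤ W j) (a j)) :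
    ∃ b : G.val.obj (op V), ∀ i, modRes G.val (hW i) b = a i := by
  have hc : TopCat.Presheaf.IsCompatible G.val.presheaf W a := fun i j => h i j
  obtain ⟨b, hb, -⟩ := TopCat.Sheaf.existsUnique_gluing' ⟨G.val.presheaf, G.isSheaf⟩ W V
    (fun i => homOfLE (hW i)) (fun x hx => Opens.mem_iSup.2 (hcover x hx)) a hc
  exact ⟨b, hb⟩

/-- `u` is a multiplicative Čech 1-cocycle of `R` on the open sets `U i`: one has `u i i = 1` and
`u i j * u j k = u i k` on each open set contained in `U i`, `U j` and `U k`. These conditions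
force the `u i j` to be units. -/
structure IsCocycle (R : RingSheaf T) {ι : Type*} (U : ι → Opens T)
    (u : ∀ i j, R.obj.obj (op (U i ⊓ U j))) : Prop where
  one : ∀ i, u i i = 1
  mul : ∀ i j k (V : Opens T) (hi : V ≤ U i) (hj : V ≤ U j) (hk : V ≤ U k),
    ringRes R (le_inf hi hj) (u i j) * ringRes R (le_inf hj hk) (u j k) =
      ringRes R (le_inf hi hk) (u i k)

lemma IsCocycle.mul_symm {ι : Type*} {U : ι → Opens T} {u : ∀ i j, R.obj.obj (op (U i ⊓ U j))}
    (hu : IsCocycle R U u) (i j : ι) {V : Opens T} (hi : V ≤ U i) (hj : V ≤ U j) :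
    ringRes R (le_inf hi hj) (u i j) * ringRes R (le_inf hj hi) (u j i) = 1 := by
  rw [hu.mul i j i V hi hj hi, hu.one, map_one]

/-- The sections `s i` are bases of `M` over the open sets `U i`, and `u` is the cocycle of the
transition functions: `s i = u i j • s j`. -/
structure IsTriv {ι : Type*} (M : ModPresheaf R) (U : ι → Opens T)
    (s : ∀ i, M.obj (op (U i))) (u : ∀ i j, R.obj.obj (op (U i ⊓ U j))) : Prop where
  gen : ∀ i, IsGen M (s i)
  trans : ∀ i j, modRes M inf_le_left (s i) = u i j • modRes M inf_le_right (s j)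

variable {ι : Type*} {U : ι → Opens T}

lemma IsTriv.trans' {M : ModPresheaf R} {s : ∀ i, M.obj (op (U i))}
    {u : ∀ i j, R.obj.obj (op (U i ⊓ U j))}
    (h : ∀ i j, modRes M inf_le_left (s i) = u i j • modRes M inf_le_right (s j))
    (i j : ι) {V : Opens T} (hi : V ≤ U i) (hj : V ≤ U j) :
    modRes M hi (s i) = ringRes R (le_inf hi hj) (u i j) • modRes M hj (s j) := by
  have := congr_arg (modRes M (le_inf hi hj)) (h i j)
  rwa [modRes_modRes, modRes_smul, modRes_modRes] at this

lemma IsTriv.isCocycle {M : ModPresheaf R} {s : ∀ i, M.obj (op (U i))}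
    {u : ∀ i j, R.obj.obj (op (U i ⊓ U j))} (h : IsTriv M U s u) : IsCocycle R U u where
  one i := by
    apply ((h.gen i).modRes_bijective (inf_le_left : U i ⊓ U i ≤ U i)).1
    dsimp only
    rw [one_smul]
    exact (h.trans i i).symm
  mul i j k V hi hj hk := by
    apply ((h.gen k).modRes_bijective hk).1
    dsimp only
    rw [mul_smul, ← trans' h.trans j k hj hk, ← trans' h.trans i j hi hj,
      ← trans' h.trans i k hi hk]

/-- A morphism from an invertible sheaf to a sheaf of modules is determined by the images of local
bases, which can be prescribed subject to the transition relations. -/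
theorem IsTriv.existsUnique_hom (hU : ∀ x : T, ∃ i, x ∈ U i) {M : ModPresheaf R}
    {s : ∀ i, M.obj (op (U i))} {u : ∀ i j, R.obj.obj (op (U i ⊓ U j))} (h : IsTriv M U s u)
    (G : ModSheaf R) (n : ∀ i, G.val.obj (op (U i)))
    (hn : ∀ i j, modRes G.val inf_le_left (n i) = u i j • modRes G.val inf_le_right (n j)) :
    ∃! f : M ⟶ G.val, ∀ i, f.app _ (s i) = n i := by
  have hcov : ∀ (V : Opens T), ∀ x ∈ V, ∃ i, x ∈ V ⊓ U i := fun V x hx =>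
    (hU x).imp fun i hi => ⟨hx, hi⟩
  -- the image of `m` is characterized by its restrictions to the open sets `U i`
  let Q : ∀ (V : Opens T), M.obj (op V) → G.val.obj (op V) → Prop := fun V m g =>
    ∀ i (W : Opens T) (hV : W ≤ V) (hi : W ≤ U i) (r : R.obj.obj (op W)),
      r • modRes M hi (s i) = modRes M hV m → modRes G.val hV g = r • modRes G.val hi (n i)
  have huniq : ∀ V m g g', Q V m g → Q V m g' → g = g' := fun V m g g' hg hg' => by
    refine modSheaf_eq_of_locally_eq G (fun i => V ⊓ U i) (fun i => inf_le_left) (hcov V)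
      fun i => ?_
    obtain ⟨r, hr⟩ := ((h.gen i).modRes_bijective (inf_le_right : V ⊓ U i ≤ U i)).2
      (modRes M inf_le_left m)
    rw [hg i _ inf_le_left inf_le_right r hr, hg' i _ inf_le_left inf_le_right r hr]
  have key : ∀ {W : Opens T} {i j : ι} (hi : W ≤ U i) (hj : W ≤ U j) (r r' : R.obj.obj (op W)),
      r • modRes M hi (s i) = r' • modRes M hj (s j) →
        r • modRes G.val hi (n i) = r' • modRes G.val hj (n j) := by
    intro W i j hi hj r r' hr
    rw [trans' h.trans i j hi hj, ← mul_smul] at hr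
    rw [trans' hn i j hi hj, ← mul_smul, ((h.gen j).modRes_bijective hj).1 hr]
  have hex : ∀ V m, ∃ g, Q V m g := fun V m => by
    choose r hr using fun i => ((h.gen i).modRes_bijective (inf_le_right : V ⊓ U i ≤ U i)).2
      (modRes M inf_le_left m)
    dsimp only at hr
    obtain ⟨g, hg⟩ := modSheaf_exists_glue G (fun i => V ⊓ U i) (fun i => inf_le_left) (hcov V)
      (fun i => r i • modRes G.val inf_le_right (n i)) fun i j => by
        rw [modRes_smul, modRes_smul, modRes_modRes, modRes_modRes]
        apply key
        rw [← modRes_modRes M inf_le_left inf_le_right (s i), ← modRes_smul, hr,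
          ← modRes_modRes M inf_le_right inf_le_right (s j), ← modRes_smul, hr, modRes_modRes,
          modRes_modRes]
    refine ⟨g, fun i W hV hi r' hr' => ?_⟩
    have h1 := congr_arg (modRes G.val (le_inf hV hi)) (hg i)
    rw [modRes_modRes, modRes_smul, modRes_modRes] at h1
    rw [h1]
    apply key
    rw [hr', ← modRes_modRes M (le_inf hV hi) inf_le_left m, ← hr, modRes_smul, modRes_modRes]
  choose F hF using hex
  have hres : ∀ {V W : Opens T} (hWV : W ≤ V) m, F W (modRes M hWV m) = modRes G.val hWV (F V m) :=
    fun {V W} hWV m => huniq W _ _ _ (hF W _) fun i Z hZ hi r hr => by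
      rw [modRes_modRes] at hr ⊢
      exact hF V m i Z _ hi r hr
  have hadd : ∀ V m m', F V (m + m') = F V m + F V m' := fun V m m' =>
    huniq V _ _ _ (hF V _) fun i W hV hi r hr => by
      obtain ⟨a, ha⟩ := ((h.gen i).modRes_bijective hi).2 (modRes M hV m)
      obtain ⟨b, hb⟩ := ((h.gen i).modRes_bijective hi).2 (modRes M hV m')
      dsimp only at ha hb
      have : r = a + b := ((h.gen i).modRes_bijective hi).1 (by
        dsimp only; rw [hr, map_add, add_smul, ha, hb])
      rw [map_add, hF V m i W hV hi a ha, hF V m' i W hV hi b hb, this, add_smul]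
  have hsmul : ∀ V (r : R.obj.obj (op V)) m, F V (r • m) = r • F V m := fun V r m =>
    huniq V _ _ _ (hF V _) fun i W hV hi r' hr => by
      obtain ⟨a, ha⟩ := ((h.gen i).modRes_bijective hi).2 (modRes M hV m)
      dsimp only at ha
      have : r' = ringRes R hV r * a := ((h.gen i).modRes_bijective hi).1 (by
        dsimp only; rw [hr, modRes_smul, mul_smul, ha])
      rw [modRes_smul, hF V m i W hV hi a ha, this, mul_smul]
  let f : M ⟶ G.val := PresheafOfModules.homMk
    { app := fun V => AddCommGrpCat.ofHom (AddMonoidHom.mk' (F V.unop) (hadd V.unop))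
      naturality := fun V W i => by
        ext m
        exact hres i.unop.le m }
    (fun V r m => hsmul V.unop r m)
  refine ⟨f, fun i => ?_, fun f' hf' => ?_⟩
  · have := hF (U i) (s i) i (U i) le_rfl le_rfl 1 (one_smul _ _)
    rw [one_smul, modRes_self, modRes_self] at this
    exact this
  · ext V m
    refine huniq V.unop m _ _ (fun i W hV hi r hr => ?_) (hF V.unop m)
    rw [← app_modRes f' hV, ← hr, app_smul, app_modRes, hf' i]

/-- Two invertible sheaves with the same transition functions are isomorphic. -/
theorem IsTriv.nonempty_iso (hU : ∀ x : T, ∃ i, x ∈ U i) {M N : ModSheaf R}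
    {s : ∀ i, M.val.obj (op (U i))} {t : ∀ i, N.val.obj (op (U i))}
    {u : ∀ i j, R.obj.obj (op (U i ⊓ U j))} (h : IsTriv M.val U s u) (h' : IsTriv N.val U t u) :
    Nonempty (M ≅ N) := by
  obtain ⟨f, hf, -⟩ := h.existsUnique_hom hU N t h'.trans
  obtain ⟨g, hg, -⟩ := h'.existsUnique_hom hU M s h.trans
  refine ⟨⟨⟨f⟩, ⟨g⟩, ?_, ?_⟩⟩
  · apply SheafOfModules.hom_ext
    refine (h.existsUnique_hom hU M s h.trans).unique (fun i => ?_) fun i => rfl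
    exact (congr_arg (g.app _) (hf i)).trans (hg i)
  · apply SheafOfModules.hom_ext
    refine (h'.existsUnique_hom hU N t h'.trans).unique (fun i => ?_) fun i => rfl
    exact (congr_arg (f.app _) (hg i)).trans (hf i)

lemma IsTriv.congr {M : ModPresheaf R} {s : ∀ i, M.obj (op (U i))}
    {u v : ∀ i j, R.obj.obj (op (U i ⊓ U j))}
    (h : IsTriv M U s u) (huv : ∀ i j, u i j = v i j) : IsTriv M U s v := by
  rwa [← funext fun i => funext (huv i)]

lemma IsTriv.restrict {M : ModPresheaf R} {s : ∀ i, M.obj (op (U i))}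
    {u : ∀ i j, R.obj.obj (op (U i ⊓ U j))} (h : IsTriv M U s u) {κ : Type*} {V : κ → Opens T}
    (c : κ → ι) (hV : ∀ k, V k ≤ U (c k)) :
    IsTriv M V (fun k => modRes M (hV k) (s (c k)))
      (fun k l => ringRes R (inf_le_inf (hV k) (hV l)) (u (c k) (c l))) where
  gen k := (h.gen (c k)).restrict _
  trans k l := by
    rw [modRes_modRes, modRes_modRes]
    exact trans' h.trans _ _ _ _

lemma IsTriv.map_isLocBij {P : ModPresheaf R} {M : ModSheaf R} {f : P ⟶ M.val} (hf : IsLocBij f)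
    {s : ∀ i, P.obj (op (U i))}
    {u : ∀ i j, R.obj.obj (op (U i ⊓ U j))} (h : IsTriv P U s u) :
    IsTriv M.val U (fun i => f.app _ (s i)) u where
  gen i := (h.gen i).of_isLocBij hf
  trans i j := by rw [← app_modRes, ← app_modRes, h.trans, app_smul]

lemma IsTriv.map_iso {M N : ModSheaf R} (e : M ≅ N) {s : ∀ i, M.val.obj (op (U i))}
    {u : ∀ i j, R.obj.obj (op (U i ⊓ U j))} (h : IsTriv M.val U s u) :
    IsTriv N.val U (fun i => e.hom.val.app _ (s i)) u := by
  refine h.map_isLocBij (f := e.hom.val) ?_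
  have h1 : ∀ (V : Opens T) (m : M.val.obj (op V)), e.inv.val.app _ (e.hom.val.app _ m) = m :=
    fun V m => congr(($(e.hom_inv_id)).val.app (op V) m)
  have h2 : ∀ (V : Opens T) (m : N.val.obj (op V)), e.hom.val.app _ (e.inv.val.app _ m) = m :=
    fun V m => congr(($(e.inv_hom_id)).val.app (op V) m)
  refine ⟨fun V m hm x hx => ⟨V, 𝟙 V, hx, ?_⟩, fun V n x hx => ⟨V, 𝟙 V, hx, ?_⟩⟩
  · rw [← h1 V m, hm, map_zero, map_zero]
  · exact ⟨e.inv.val.app _ (res N.val (𝟙 V) n), h2 V _⟩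

lemma IsTriv.tensorPresheaf {M N : ModPresheaf R} {s : ∀ i, M.obj (op (U i))}
    {t : ∀ i, N.obj (op (U i))} {u v : ∀ i j, R.obj.obj (op (U i ⊓ U j))}
    (h : IsTriv M U s u) (h' : IsTriv N U t v) :
    IsTriv (M ⊗ N) U (fun i => pureTensor (s i) (t i)) (fun i j => u i j * v i j) where
  gen i := (h.gen i).tmul (h'.gen i)
  trans i j := by
    refine (res_pureTensor _ _ _).trans ?_
    refine (congr_arg₂ pureTensor (h.trans i j) (h'.trans i j)).trans ?_
    exact TensorProduct.smul_tmul_smul (R := R.obj.obj (op (U i ⊓ U j))) _ _ _ _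

end Cocycles

/-! ### Invertible sheaves and cocycles -/

section CocycleSheaf

variable {T : TopCat.{u}} {R : RingSheaf T} {ι : Type u} {U : ι → Opens T}

/-- The sections over `V` of the invertible module with transition functions `u`: the families
`a i ∈ R(V ⊓ U i)` of coordinates, with `a j = a i * u i j`. -/
def cocycleSec (u : ∀ i j, R.obj.obj (op (U i ⊓ U j))) (V : Opens T) :
    AddSubgroup (∀ i, R.obj.obj (op (V ⊓ U i))) where
  carrier := {a | ∀ i j (W : Opens T) (hV : W ≤ V) (hi : W ≤ U i) (hj : W ≤ U j),
    ringRes R (le_inf hV hj) (a j) = ringRes R (le_inf hV hi) (a i) *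
      ringRes R (le_inf hi hj) (u i j)}
  add_mem' {a b} ha hb i j W hV hi hj := by
    rw [Pi.add_apply, Pi.add_apply, map_add, map_add, ha i j W hV hi hj, hb i j W hV hi hj,
      add_mul]
  zero_mem' i j W hV hi hj := by
    rw [Pi.zero_apply, Pi.zero_apply, map_zero, map_zero, zero_mul]
  neg_mem' {a} ha i j W hV hi hj := by
    rw [Pi.neg_apply, Pi.neg_apply, map_neg, map_neg, ha i j W hV hi hj, neg_mul]

instance (u : ∀ i j, R.obj.obj (op (U i ⊓ U j))) (V : Opens T) :
    SMul (R.obj.obj (op V)) (cocycleSec u V) where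
  smul r a := ⟨fun i => ringRes R inf_le_left r * a.1 i, fun i j W hV hi hj => by
    rw [map_mul, map_mul, a.2 i j W hV hi hj, ringRes_ringRes, ringRes_ringRes, mul_assoc]⟩

lemma cocycleSec_smul_apply (u : ∀ i j, R.obj.obj (op (U i ⊓ U j))) {V : Opens T}
    (r : R.obj.obj (op V)) (a : cocycleSec u V) (i : ι) :
    (r • a).1 i = ringRes R inf_le_left r * a.1 i := rfl

lemma cocycleSec_ext {u : ∀ i j, R.obj.obj (op (U i ⊓ U j))} {V : Opens T}
    {a b : cocycleSec u V} (h : ∀ i, a.1 i = b.1 i) : a = b := Subtype.ext (funext h)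

instance (u : ∀ i j, R.obj.obj (op (U i ⊓ U j))) (V : Opens T) :
    Module (R.obj.obj (op V)) (cocycleSec u V) where
  one_smul a := cocycleSec_ext fun i => by
    rw [cocycleSec_smul_apply, map_one, one_mul]
  mul_smul r r' a := cocycleSec_ext fun i => by
    rw [cocycleSec_smul_apply, cocycleSec_smul_apply, cocycleSec_smul_apply, map_mul, mul_assoc]
  smul_zero r := cocycleSec_ext fun i => by
    rw [cocycleSec_smul_apply]; exact mul_zero _
  smul_add r a b := cocycleSec_ext fun i => by
    rw [cocycleSec_smul_apply]; exact mul_add _ _ _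
  add_smul r r' a := cocycleSec_ext fun i => by
    rw [cocycleSec_smul_apply, map_add]; exact add_mul _ _ _
  zero_smul a := cocycleSec_ext fun i => by
    rw [cocycleSec_smul_apply, map_zero]; exact zero_mul _

/-- The restriction of sections of the module with transition functions `u`. -/
def cocycleRes (u : ∀ i j, R.obj.obj (op (U i ⊓ U j))) {V W : Opens T} (h : W ≤ V) :
    cocycleSec u V →+ cocycleSec u W where
  toFun a := ⟨fun i => ringRes R (inf_le_inf_right _ h) (a.1 i), fun i j Z hZ hi hj => by
    rw [ringRes_ringRes, ringRes_ringRes]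
    exact a.2 i j Z (hZ.trans h) hi hj⟩
  map_zero' := cocycleSec_ext fun i => map_zero (ringRes R _)
  map_add' a b := cocycleSec_ext fun i => map_add (ringRes R _) _ _

lemma cocycleRes_apply (u : ∀ i j, R.obj.obj (op (U i ⊓ U j))) {V W : Opens T} (h : W ≤ V)
    (a : cocycleSec u V) (i : ι) :
    (cocycleRes u h a).1 i = ringRes R (inf_le_inf_right _ h) (a.1 i) := rfl

lemma cocycleRes_smul (u : ∀ i j, R.obj.obj (op (U i ⊓ U j))) {V W : Opens T} (h : W ≤ V)
    (r : R.obj.obj (op V)) (a : cocycleSec u V) :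
    cocycleRes u h (r • a) = ringRes R h r • cocycleRes u h a := cocycleSec_ext fun i => by
  rw [cocycleRes_apply, cocycleSec_smul_apply, cocycleSec_smul_apply, cocycleRes_apply, map_mul,
    ringRes_ringRes, ringRes_ringRes]

/-- The abelian presheaf underlying the invertible module with transition functions `u`. -/
def cocycleAbPresheaf (u : ∀ i j, R.obj.obj (op (U i ⊓ U j))) : (Opens T)ᵒᵖ ⥤ Ab.{u} where
  obj V := AddCommGrpCat.of (cocycleSec u V.unop)
  map f := AddCommGrpCat.ofHom (cocycleRes u f.unop.le)
  map_id _ := AddCommGrpCat.hom_ext <| AddMonoidHom.ext fun a =>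
    cocycleSec_ext (u := u) fun i => ringRes_self (R := R) _ (a.1 i)
  map_comp f g := AddCommGrpCat.hom_ext <| AddMonoidHom.ext fun a =>
    cocycleSec_ext (u := u) fun i => (ringRes_ringRes (R := R) (inf_le_inf_right _ g.unop.le)
      (inf_le_inf_right _ f.unop.le) (a.1 i)).symm

instance (u : ∀ i j, R.obj.obj (op (U i ⊓ U j))) (V : (Opens T)ᵒᵖ) :
    Module ((R.obj ⋙ forget₂ CommRingCat RingCat.{u}).obj V) ((cocycleAbPresheaf u).obj V) :=
  inferInstanceAs (Module (R.obj.obj (op V.unop)) (cocycleSec u V.unop))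

/-- The presheaf of modules with transition functions `u`. -/
def cocyclePresheaf (u : ∀ i j, R.obj.obj (op (U i ⊓ U j))) : ModPresheaf R :=
  PresheafOfModules.ofPresheaf (cocycleAbPresheaf u)
    (fun _ _ f r a => cocycleRes_smul u f.unop.le r a)

/-- The basis over `U i` of the module with transition functions `u`. -/
def cocycleGen {u : ∀ i j, R.obj.obj (op (U i ⊓ U j))} (hu : IsCocycle R U u) (i : ι) :
    cocycleSec u (U i) :=
  ⟨fun j => u i j, fun j k W hi hj hk => (hu.mul i j k W hi hj hk).symm⟩

lemma isTriv_cocyclePresheaf {u : ∀ i j, R.obj.obj (op (U i ⊓ U j))} (hu : IsCocycle R U u) :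
    IsTriv (cocyclePresheaf u) U (cocycleGen hu) u where
  gen i := by
    intro V f
    have hV : V ≤ U i := f.le
    have key : ∀ (r : R.obj.obj (op V)) (j : ι),
        (show cocycleSec u V from r • res (cocyclePresheaf u) f
          (cocycleGen hu i : (cocyclePresheaf u).obj (op (U i)))).1 j =
          ringRes R inf_le_left r * ringRes R (inf_le_inf_right _ hV) (u i j) := fun r j => rfl
    refine ⟨fun r r' h => ?_, fun a => ?_⟩
    · have h1 := congr_arg (fun a : cocycleSec u V => ringRes R (le_inf le_rfl hV) (a.1 i)) h
      dsimp only at h1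
      erw [key, key] at h1
      simpa only [hu.one, map_one, mul_one, ringRes_ringRes, ringRes_self] using h1
    · change cocycleSec u V at a
      refine ⟨ringRes R (le_inf le_rfl hV) (a.1 i), Subtype.ext <| funext fun j => ?_⟩
      refine (key _ j).trans ?_
      have := a.2 i j (V ⊓ U j) inf_le_left (inf_le_left.trans hV) inf_le_right
      rw [ringRes_self] at this
      rw [this, ringRes_ringRes]
  trans i j := by
    refine Subtype.ext <| funext fun k => ?_
    exact (hu.mul i j k _ (inf_le_left.trans inf_le_left) (inf_le_left.trans inf_le_right)
      inf_le_right).symm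

/-- Each cocycle is the cocycle of transition functions of an invertible sheaf. -/
theorem IsCocycle.exists_invertibleSheaf (hU : ∀ x : T, ∃ i, x ∈ U i)
    {u : ∀ i j, R.obj.obj (op (U i ⊓ U j))} (hu : IsCocycle R U u) :
    ∃ (L : InvertibleSheaf R) (s : ∀ i, L.carrier.val.obj (op (U i))),
      IsTriv L.carrier.val U s u := by
  have h := (isTriv_cocyclePresheaf hu).map_isLocBij (isLocBij_toSheafify _)
  exact ⟨⟨_, fun x => (hU x).imp' _ fun i hi => ⟨hi, _, h.gen i⟩⟩, _, h⟩

/-- Each class in `Pic` has representatives by cocycles. -/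
lemma InvertibleSheaf.exists_isTriv (L : InvertibleSheaf R) :
    ∃ (U : T → Opens T) (_ : ∀ x, x ∈ U x) (s : ∀ x, L.carrier.val.obj (op (U x)))
      (u : ∀ x y, R.obj.obj (op (U x ⊓ U y))), IsTriv L.carrier.val U s u := by
  choose U hU s hs using L.locFree
  choose u hu using fun x y => ((hs y).modRes_bijective (inf_le_right : U x ⊓ U y ≤ U y)).2
    (modRes _ inf_le_left (s x))
  exact ⟨U, hU, s, u, hs, fun x y => (hu x y).symm⟩

/-- The element `a` of `Pic` is represented by the cocycle `u`. -/
def HasCocycle (a : Pic R) (U : ι → Opens T) (u : ∀ i j, R.obj.obj (op (U i ⊓ U j))) : Prop :=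
  ∃ (L : InvertibleSheaf R) (s : ∀ i, L.carrier.val.obj (op (U i))),
    Pic.mk L = a ∧ IsTriv L.carrier.val U s u

lemma HasCocycle.exists_isTriv {L : InvertibleSheaf R} {u : ∀ i j, R.obj.obj (op (U i ⊓ U j))}
    (h : HasCocycle (Pic.mk L) U u) :
    ∃ s : ∀ i, L.carrier.val.obj (op (U i)), IsTriv L.carrier.val U s u := by
  obtain ⟨L', s, h1, h2⟩ := h
  obtain ⟨e⟩ := _root_.Quotient.exact h1
  exact ⟨_, h2.map_iso e⟩

lemma HasCocycle.isCocycle {a : Pic R} {u : ∀ i j, R.obj.obj (op (U i ⊓ U j))}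
    (h : HasCocycle a U u) : IsCocycle R U u := by
  obtain ⟨L, s, -, h⟩ := h
  exact h.isCocycle

lemma HasCocycle.unique (hU : ∀ x : T, ∃ i, x ∈ U i) {a b : Pic R}
    {u : ∀ i j, R.obj.obj (op (U i ⊓ U j))}
    (h : HasCocycle a U u) (h' : HasCocycle b U u) : a = b := by
  obtain ⟨L, s, rfl, h⟩ := h
  obtain ⟨L', s', rfl, h'⟩ := h'
  exact _root_.Quotient.sound (h.nonempty_iso hU h')

lemma HasCocycle.restrict {a : Pic R} {u : ∀ i j, R.obj.obj (op (U i ⊓ U j))}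
    (h : HasCocycle a U u) {κ : Type u} {V : κ → Opens T} (c : κ → ι) (hV : ∀ k, V k ≤ U (c k)) :
    HasCocycle a V (fun k l => ringRes R (inf_le_inf (hV k) (hV l)) (u (c k) (c l))) := by
  obtain ⟨L, s, h1, h⟩ := h
  exact ⟨L, _, h1, h.restrict c hV⟩

lemma HasCocycle.mul {a b : Pic R} {u v : ∀ i j, R.obj.obj (op (U i ⊓ U j))}
    (h : HasCocycle a U u) (h' : HasCocycle b U v) :
    HasCocycle (a * b) U (fun i j => u i j * v i j) := by
  obtain ⟨L, s, rfl, h⟩ := h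
  obtain ⟨L', s', rfl, h'⟩ := h'
  exact ⟨⟨tensor R L.carrier L'.carrier, L.locFree.tensorSheaf L'.locFree⟩, _, rfl,
    (h.tensorPresheaf h').map_isLocBij (isLocBij_toSheafify _)⟩

lemma hasCocycle_one : HasCocycle (1 : Pic R) U (fun _ _ => 1) := by
  refine ⟨⟨SheafOfModules.unit (toRingCatSheaf R), locallyFreeRankOne_unit⟩,
    fun i => (1 : R.obj.obj (op (U i))), rfl, fun i => isGen_one _, fun i j => ?_⟩
  exact (map_one (ringRes R _)).trans
    ((map_one (ringRes R _)).symm.trans (one_mul (ringRes R _ (1 : R.obj.obj (op (U j))))).symm)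

lemma HasCocycle.pow {a : Pic R} {u : ∀ i j, R.obj.obj (op (U i ⊓ U j))}
    (h : HasCocycle a U u) (n : ℕ) : HasCocycle (a ^ n) U (fun i j => u i j ^ n) := by
  induction n with
  | zero => simpa only [pow_zero] using hasCocycle_one
  | succ n ih => simpa only [pow_succ] using ih.mul h

lemma IsCocycle.inv {u : ∀ i j, R.obj.obj (op (U i ⊓ U j))} (hu : IsCocycle R U u) :
    IsCocycle R U (fun i j => ringRes R (le_inf inf_le_right inf_le_left) (u j i)) where
  one i := by rw [hu.one, map_one]
  mul i j k V hi hj hk := by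
    rw [ringRes_ringRes, ringRes_ringRes, ringRes_ringRes, mul_comm]
    exact hu.mul k j i V hk hj hi

lemma IsCocycle.mul_cocycle {u v : ∀ i j, R.obj.obj (op (U i ⊓ U j))} (hu : IsCocycle R U u)
    (hv : IsCocycle R U v) : IsCocycle R U (fun i j => u i j * v i j) where
  one i := by rw [hu.one, hv.one, mul_one]
  mul i j k V hi hj hk := by
    rw [map_mul, map_mul, map_mul, mul_mul_mul_comm, hu.mul i j k V hi hj hk,
      hv.mul i j k V hi hj hk]

lemma IsCocycle.restrict {u : ∀ i j, R.obj.obj (op (U i ⊓ U j))} (hu : IsCocycle R U u)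
    {κ : Type u} {V : κ → Opens T} (c : κ → ι) (hV : ∀ k, V k ≤ U (c k)) :
    IsCocycle R V (fun k l => ringRes R (inf_le_inf (hV k) (hV l)) (u (c k) (c l))) where
  one i := by rw [hu.one, map_one]
  mul i j k W hi hj hk := by
    rw [ringRes_ringRes, ringRes_ringRes, ringRes_ringRes]
    exact hu.mul _ _ _ W (hi.trans (hV _)) (hj.trans (hV _)) (hk.trans (hV _))

lemma HasCocycle.congr {a : Pic R} {u v : ∀ i j, R.obj.obj (op (U i ⊓ U j))}
    (h : HasCocycle a U u) (huv : ∀ i j, u i j = v i j) : HasCocycle a U v := by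
  rwa [← funext fun i => funext (huv i)]

lemma HasCocycle.inv (hU : ∀ x : T, ∃ i, x ∈ U i) {a : Pic R}
    {u : ∀ i j, R.obj.obj (op (U i ⊓ U j))} (h : HasCocycle a U u) :
    HasCocycle a⁻¹ U (fun i j => ringRes R (le_inf inf_le_right inf_le_left) (u j i)) := by
  obtain ⟨L, s, hL⟩ := h.isCocycle.inv.exists_invertibleSheaf hU
  have h' : HasCocycle (Pic.mk L) U _ := ⟨L, s, rfl, hL⟩
  have h1 := h.mul h'
  have : (fun i j => u i j * ringRes R (le_inf inf_le_right inf_le_left) (u j i)) =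
      fun i j => 1 := by
    funext i j
    have := h.isCocycle.mul_symm i j inf_le_left inf_le_right
    rwa [ringRes_self] at this
  rw [this] at h1
  rw [inv_eq_of_mul_eq_one_right (h1.unique hU hasCocycle_one)]
  exact h'

/-- Two cocycles representing the same class on the same covering differ by a coboundary. -/
lemma HasCocycle.exists_coboundary {a : Pic R} {u v : ∀ i j, R.obj.obj (op (U i ⊓ U j))}
    (h : HasCocycle a U u) (h' : HasCocycle a U v) :
    ∃ w : ∀ i, R.obj.obj (op (U i)), (∀ i, IsUnit (w i)) ∧
      ∀ i j, u i j * ringRes R inf_le_right (w j) = ringRes R inf_le_left (w i) * v i j := by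
  obtain ⟨L, t, rfl, h'⟩ := h'
  obtain ⟨s, h⟩ := h.exists_isTriv
  choose w hw using fun i => (h'.gen i).bij.2 (s i)
  choose w' hw' using fun i => (h.gen i).bij.2 (t i)
  dsimp only at hw hw'
  refine ⟨w, fun i => IsUnit.of_mul_eq_one (w' i) ((h.gen i).bij.1 ?_), fun i j => ?_⟩
  · dsimp only
    rw [mul_smul, hw', hw, one_smul]
  · apply ((h'.gen j).modRes_bijective (inf_le_right : U i ⊓ U j ≤ U j)).1
    dsimp only
    rw [mul_smul, ← modRes_smul, hw, ← h.trans i j, mul_smul, ← h'.trans i j, ← modRes_smul, hw]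

end CocycleSheaf

/-! ### Inverse images of invertible sheaves -/

section InverseImage

variable {Z W : RingedSpace.{u}} (g : Z ⟶ W)

/-- The homomorphism `O_W(U) → O_Z(g⁻¹ U)`. -/
def comorphism (U : Opens W.carrier) :
    (structureSheaf W).obj.obj (op U) →+*
      (structureSheaf Z).obj.obj (op ((Opens.map g.hom.base).obj U)) :=
  (g.hom.c.app (op U)).hom

lemma ringRes_comorphism {V U : Opens W.carrier} (h : V ≤ U)
    (r : (structureSheaf W).obj.obj (op U)) :
    ringRes (structureSheaf Z) ((Opens.map g.hom.base).monotone h) (comorphism g U r) =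
      comorphism g V (ringRes (structureSheaf W) h r) :=
  (congr($(g.hom.c.naturality (homOfLE h).op) r)).symm

/-- The homomorphism `O_W(U) → O_Z(V)` for an open set `V` contained in `g⁻¹ U`. -/
def comorphismLE {V : Opens Z.carrier} {U : Opens W.carrier}
    (h : V ≤ (Opens.map g.hom.base).obj U) :
    (structureSheaf W).obj.obj (op U) →+* (structureSheaf Z).obj.obj (op V) :=
  (ringRes (structureSheaf Z) h).comp (comorphism g U)

variable {g} in
lemma ringRes_comorphismLE {V V' : Opens Z.carrier} {U : Opens W.carrier}
    (h : V ≤ (Opens.map g.hom.base).obj U) (h' : V' ≤ V) (r : (structureSheaf W).obj.obj (op U)) :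
    ringRes (structureSheaf Z) h' (comorphismLE g h r) = comorphismLE g (h'.trans h) r :=
  ringRes_ringRes _ _ _

variable {g} in
lemma comorphismLE_ringRes {V : Opens Z.carrier} {U U' : Opens W.carrier} (h' : U' ≤ U)
    (h : V ≤ (Opens.map g.hom.base).obj U') (r : (structureSheaf W).obj.obj (op U)) :
    comorphismLE g h (ringRes (structureSheaf W) h' r) =
      comorphismLE g (h.trans ((Opens.map g.hom.base).monotone h')) r := by
  rw [comorphismLE, RingHom.comp_apply, ← ringRes_comorphism, ringRes_ringRes]
  rfl

lemma map_inf_le (U V : Opens W.carrier) :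
    (Opens.map g.hom.base).obj U ⊓ (Opens.map g.hom.base).obj V ≤
      (Opens.map g.hom.base).obj (U ⊓ V) := le_rfl

/-- The functor `g_*` on sheaves of modules, right adjoint to `inverseImage g`. -/
def directImage : ModSheaf (structureSheaf Z) ⥤ ModSheaf (structureSheaf W) :=
  SheafOfModules.pushforward.{u} (ringMap g)

/-- The adjunction between inverse image and direct image. -/
def inverseImageAdjunction : inverseImage g ⊣ directImage g :=
  have := pushforward_isRightAdjoint g.hom.base (structureSheaf Z) (structureSheaf W) (ringMap g)
  SheafOfModules.pullbackPushforwardAdjunction.{u} (ringMap g)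

variable {g} in
/-- Pulling back an invertible sheaf amounts to pulling back its transition functions. -/
theorem IsTriv.nonempty_inverseImage_iso {ι : Type*} {U : ι → Opens W.carrier}
    (hU : ∀ x : W.carrier, ∃ i, x ∈ U i)
    {M : ModSheaf (structureSheaf W)} {L : ModSheaf (structureSheaf Z)}
    {s : ∀ i, M.val.obj (op (U i))}
    {m : ∀ i j, (structureSheaf W).obj.obj (op (U i ⊓ U j))} (hM : IsTriv M.val U s m)
    {t : ∀ i, L.val.obj (op ((Opens.map g.hom.base).obj (U i)))}
    (hL : IsTriv L.val (fun i => (Opens.map g.hom.base).obj (U i)) t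
      (fun i j => comorphismLE g (map_inf_le g _ _) (m i j))) :
    Nonempty ((inverseImage g).obj M ≅ L) := by
  have hU' : ∀ x : Z.carrier, ∃ i, x ∈ (Opens.map g.hom.base).obj (U i) := fun x =>
    hU (g.hom.base x)
  replace hL := hL.congr (v := fun i j => comorphism g _ (m i j)) fun i j => ringRes_self _ _
  let adj := inverseImageAdjunction g
  let A := (inverseImage g).obj M
  let η : M ⟶ (directImage g).obj A := adj.unit.app M
  obtain ⟨φ, hφ, -⟩ := hM.existsUnique_hom hU ((directImage g).obj L) t hL.trans
  let α : A ⟶ L := (adj.homEquiv M L).symm ⟨φ⟩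
  have hα : η ≫ (directImage g).map α = ⟨φ⟩ := by
    rw [← adj.homEquiv_unit]
    exact (adj.homEquiv M L).apply_symm_apply _
  have hα' : ∀ i, α.val.app _ (show A.val.obj (op ((Opens.map g.hom.base).obj (U i))) from
      η.val.app _ (s i)) = t i := fun i =>
    (congr(($hα).val.app _ (s i))).trans (hφ i)
  have hη : ∀ i j, modRes ((directImage g).obj A).val inf_le_left (η.val.app _ (s i)) =
      m i j • modRes ((directImage g).obj A).val inf_le_right (η.val.app _ (s j)) := fun i j => by
    rw [← app_modRes, ← app_modRes, hM.trans, app_smul]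
  obtain ⟨β, hβ, -⟩ := hL.existsUnique_hom hU' A (fun i => η.val.app _ (s i)) hη
  refine ⟨⟨α, ⟨β⟩, ?_, ?_⟩⟩
  · apply (adj.homEquiv M A).injective
    rw [adj.homEquiv_unit, adj.homEquiv_unit]
    apply SheafOfModules.hom_ext
    refine (hM.existsUnique_hom hU ((directImage g).obj A) (fun i => η.val.app _ (s i)) hη).unique
      (fun i => ?_) (fun i => ?_)
    · exact (congr_arg (β.app _) (hα' i)).trans (hβ i)
    · exact congr(($((directImage g).map_id A)).val.app _ (η.val.app _ (s i)))
  · apply SheafOfModules.hom_ext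
    refine (hL.existsUnique_hom hU' L t hL.trans).unique (fun i => ?_) (fun i => rfl)
    exact (congr_arg (α.val.app _) (hβ i)).trans (hα' i)

variable {g} in
lemma IsCocycle.comorphism {ι : Type*} {U : ι → Opens W.carrier}
    {m : ∀ i j, (structureSheaf W).obj.obj (op (U i ⊓ U j))}
    (hm : IsCocycle (structureSheaf W) U m) :
    IsCocycle (structureSheaf Z) (fun i => (Opens.map g.hom.base).obj (U i))
      (fun i j => comorphismLE g (map_inf_le g _ _) (m i j)) where
  one i := by rw [hm.one, map_one]
  mul i j k V hi hj hk := by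
    have hV : V ≤ (Opens.map g.hom.base).obj (U i ⊓ U j ⊓ U k) := le_inf (le_inf hi hj) hk
    have := congr_arg (comorphismLE g hV) (hm.mul i j k (U i ⊓ U j ⊓ U k)
      (inf_le_left.trans inf_le_left) (inf_le_left.trans inf_le_right) inf_le_right)
    rw [map_mul, comorphismLE_ringRes, comorphismLE_ringRes, comorphismLE_ringRes] at this
    rw [ringRes_comorphismLE, ringRes_comorphismLE, ringRes_comorphismLE, this]

/-- The class `a` is the inverse image of the class of an invertible sheaf on `W`. -/
def IsLiftable (a : Pic (structureSheaf Z)) : Prop :=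
  ∃ (L : InvertibleSheaf (structureSheaf Z)) (M : InvertibleSheaf (structureSheaf W)),
    Pic.mk L = a ∧ Nonempty ((inverseImage g).obj M.carrier ≅ L.carrier)

variable {g}

/-- A class is liftable as soon as it is represented by a liftable cocycle. -/
lemma IsLiftable.of_hasCocycle {ι : Type u} {U : ι → Opens W.carrier}
    (hU : ∀ x : W.carrier, ∃ i, x ∈ U i)
    {m : ∀ i j, (structureSheaf W).obj.obj (op (U i ⊓ U j))}
    (hm : IsCocycle (structureSheaf W) U m) {a : Pic (structureSheaf Z)}
    (ha : HasCocycle a (fun i => (Opens.map g.hom.base).obj (U i))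
      (fun i j => comorphismLE g (map_inf_le g _ _) (m i j))) : IsLiftable g a := by
  obtain ⟨L, t, rfl, hL⟩ := ha
  obtain ⟨M, s, hM⟩ := hm.exists_invertibleSheaf hU
  exact ⟨L, M, rfl, hM.nonempty_inverseImage_iso hU hL⟩

/-- A liftable class is represented by a liftable cocycle. -/
lemma IsLiftable.exists_hasCocycle {a : Pic (structureSheaf Z)} (ha : IsLiftable g a) :
    ∃ (U : W.carrier → Opens W.carrier) (_ : ∀ x, x ∈ U x)
      (m : ∀ i j, (structureSheaf W).obj.obj (op (U i ⊓ U j))),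
      IsCocycle (structureSheaf W) U m ∧
        HasCocycle a (fun i => (Opens.map g.hom.base).obj (U i))
          (fun i j => comorphismLE g (map_inf_le g _ _) (m i j)) := by
  obtain ⟨L, M, rfl, ⟨e⟩⟩ := ha
  obtain ⟨U, hU, s, m, hM⟩ := M.exists_isTriv
  refine ⟨U, hU, m, hM.isCocycle, ?_⟩
  have hc := hM.isCocycle.comorphism (g := g)
  have hU' : ∀ x : W.carrier, ∃ i, x ∈ U i := fun x => ⟨x, hU x⟩
  -- the isomorphism class of `L` is determined by the transition functions of `M`
  obtain ⟨t, ht⟩ : ∃ t, IsTriv L.carrier.val (fun i => (Opens.map g.hom.base).obj (U i)) t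
      (fun i j => comorphismLE g (map_inf_le g _ _) (m i j)) := by
    have h0 := (isTriv_cocyclePresheaf hc).map_isLocBij (isLocBij_toSheafify _)
    obtain ⟨e'⟩ := hM.nonempty_inverseImage_iso hU' h0
    exact ⟨_, h0.map_iso (e'.symm ≪≫ e)⟩
  exact ⟨L, t, rfl, ht⟩

variable (g) in
/-- The subgroup of liftable classes. -/
def liftableSubgroup : Subgroup (Pic (structureSheaf Z)) where
  carrier := {a | IsLiftable g a}
  one_mem' := IsLiftable.of_hasCocycle (ι := PUnit) (U := fun _ => ⊤) (m := fun _ _ => 1)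
    (fun x => ⟨⟨⟩, trivial⟩)
    ⟨fun _ => rfl, fun i j k V hi hj hk => by simp only [map_one, mul_one]⟩
    (hasCocycle_one.congr fun i j => (map_one (comorphismLE g (map_inf_le g ⊤ ⊤))).symm)
  mul_mem' {a b} ha hb := by
    obtain ⟨U, hU, m, hm, ha⟩ := ha.exists_hasCocycle
    obtain ⟨V, hV, n, hn, hb⟩ := hb.exists_hasCocycle
    have h1 := (ha.restrict id fun x => (Opens.map g.hom.base).monotone
      (inf_le_left : U x ⊓ V x ≤ U x)).mul (hb.restrict id fun x =>
        (Opens.map g.hom.base).monotone (inf_le_right : U x ⊓ V x ≤ V x))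
    refine IsLiftable.of_hasCocycle (U := fun x => U x ⊓ V x) (fun x => ⟨x, hU x, hV x⟩)
      ((hm.restrict id fun x => inf_le_left).mul_cocycle (hn.restrict id fun x => inf_le_right))
      (h1.congr fun x y => ?_)
    rw [ringRes_comorphismLE, ringRes_comorphismLE, map_mul, comorphismLE_ringRes,
      comorphismLE_ringRes]
  inv_mem' {a} ha := by
    obtain ⟨U, hU, m, hm, ha⟩ := ha.exists_hasCocycle
    refine IsLiftable.of_hasCocycle (fun x => ⟨x, hU x⟩) hm.inv
      ((ha.inv fun x => ⟨g.hom.base x, hU _⟩).congr fun x y => ?_)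
    rw [ringRes_comorphismLE, comorphismLE_ringRes]

end InverseImage

/-! ### Vanishing of H^1 and additive cocycles -/

section Godement

variable {T : TopCat.{u}}

/-- The sheaf `U ↦ ∏ x ∈ U, F_x` of discontinuous sections of an abelian presheaf `F`. -/
def godementPresheaf (F : TopCat.Presheaf AddCommGrpCat.{u} T) :
    TopCat.Presheaf AddCommGrpCat.{u} T where
  obj U := AddCommGrpCat.of (∀ x : U.unop, F.stalk x.1)
  map i := AddCommGrpCat.ofHom
    { toFun := fun a x => a ⟨x.1, i.unop.le x.2⟩
      map_zero' := rfl
      map_add' := fun _ _ => rfl }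

lemma isSheaf_godementPresheaf (F : TopCat.Presheaf AddCommGrpCat.{u} T) :
    (godementPresheaf F).IsSheaf := by
  rw [TopCat.Presheaf.isSheaf_iff_isSheaf_comp' (forget AddCommGrpCat.{u})]
  exact TopCat.Presheaf.toTypes_isSheaf T fun x => F.stalk x

/-- The sheaf of discontinuous sections. -/
def godement (F : Sheaf (Opens.grothendieckTopology T) AddCommGrpCat.{u}) :
    Sheaf (Opens.grothendieckTopology T) AddCommGrpCat.{u} :=
  ⟨godementPresheaf F.obj, isSheaf_godementPresheaf F.obj⟩

/-- The embedding of a sheaf into the sheaf of its discontinuous sections. -/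
def toGodement (F : Sheaf (Opens.grothendieckTopology T) AddCommGrpCat.{u}) : F ⟶ godement F where
  hom :=
    { app := fun U => AddCommGrpCat.ofHom
        { toFun := fun s x => TopCat.Presheaf.germ F.obj U.unop x.1 x.2 s
          map_zero' := funext fun x => map_zero _
          map_add' := fun _ _ => funext fun x => map_add _ _ _ }
      naturality := fun U V i => by
        ext s
        funext x
        exact TopCat.Presheaf.germ_res_apply F.obj i.unop x.1 x.2 s }

lemma toGodement_injective (F : Sheaf (Opens.grothendieckTopology T) AddCommGrpCat.{u})
    (U : Opens T) : Function.Injective ((toGodement F).hom.app (op U)) := fun s t h =>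
  TopCat.Presheaf.section_ext (C := AddCommGrpCat.{u}) F U s t fun x hx => congr_fun h ⟨x, hx⟩

instance (F : Sheaf (Opens.grothendieckTopology T) AddCommGrpCat.{u}) : Mono (toGodement F) := by
  refine ⟨fun g h e => ?_⟩
  apply CategoryTheory.Sheaf.hom_ext
  ext U s
  apply toGodement_injective F U.unop
  exact congr(($e).hom.app U s)

variable (F : Sheaf (Opens.grothendieckTopology T) AddCommGrpCat.{u})

/-- The restriction maps of an abelian sheaf. -/
def abRes {V U : Opens T} (h : V ≤ U) : F.obj.obj (op U) →+ F.obj.obj (op V) :=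
  (F.obj.map (homOfLE h).op).hom

variable {F}

@[simp] lemma abRes_abRes {W V U : Opens T} (h : W ≤ V) (h' : V ≤ U) (s : F.obj.obj (op U)) :
    abRes F h (abRes F h' s) = abRes F (h.trans h') s :=
  congr($(F.obj.map_comp (homOfLE h').op (homOfLE h).op) s).symm

lemma app_abRes {G : Sheaf (Opens.grothendieckTopology T) AddCommGrpCat.{u}} (f : F ⟶ G)
    {V U : Opens T} (h : V ≤ U) (s : F.obj.obj (op U)) :
    f.hom.app (op V) (abRes F h s) = abRes G h (f.hom.app (op U) s) :=
  congr($(f.hom.naturality (homOfLE h).op) s)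

/-- The short exact sequence `0 → F → ∏ F_x → Q → 0`. -/
def godementSequence (F : Sheaf (Opens.grothendieckTopology T) AddCommGrpCat.{u}) :
    ShortComplex (Sheaf (Opens.grothendieckTopology T) AddCommGrpCat.{u}) :=
  ShortComplex.mk (toGodement F) (Limits.cokernel.π (toGodement F)) (Limits.cokernel.condition _)

lemma shortExact_godementSequence (F : Sheaf (Opens.grothendieckTopology T) AddCommGrpCat.{u}) :
    (godementSequence F).ShortExact where
  exact := ShortComplex.exact_cokernel _
  mono_f := inferInstanceAs (Mono (toGodement F))
  epi_g := inferInstanceAs (Epi (Limits.cokernel.π (toGodement F)))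

lemma exists_of_app_g_eq_zero {S : ShortComplex (Sheaf (Opens.grothendieckTopology T)
    AddCommGrpCat.{u})} (hS : S.ShortExact) {U : Opens T} (a : S.X₂.obj.obj (op U))
    (ha : S.g.hom.app (op U) a = 0) : ∃ s, S.f.hom.app (op U) s = a := by
  have := hS.mono_f
  have h := hS.exact.map_of_mono_of_preservesKernel
    (sheafToPresheaf _ AddCommGrpCat.{u} ⋙ (evaluation _ _).obj (op U)) inferInstance inferInstance
  rw [ShortComplex.ab_exact_iff] at h
  exact h a ha

/-- A portion of the long exact cohomology sequence: if `H^1` of the subsheaf vanishes, then global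
sections of the quotient lift. -/
lemma exists_lift_of_subsingleton_H {S : ShortComplex (Sheaf (Opens.grothendieckTopology T)
    AddCommGrpCat.{u})} (hS : S.ShortExact) (h : Subsingleton (Sheaf.H S.X₁ 1))
    (q : S.X₃.obj.obj (op ⊤)) : ∃ a : S.X₂.obj.obj (op ⊤), S.g.hom.app (op ⊤) a = q := by
  let hT : Limits.IsTerminal (⊤ : Opens T) := Limits.isTerminalTop
  obtain ⟨y, hy⟩ := Abelian.Ext.covariant_sequence_exact₃ _ hS
    ((Sheaf.H.equiv₀ S.X₃ hT).symm q) (zero_add 1) (Subsingleton.elim (α := Sheaf.H S.X₁ 1) _ _)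
  refine ⟨Sheaf.H.equiv₀ S.X₂ hT y, ?_⟩
  rw [Sheaf.H.equiv₀_naturality]
  exact (congr_arg (Sheaf.H.equiv₀ S.X₃ hT) hy).trans ((Sheaf.H.equiv₀ S.X₃ hT).apply_symm_apply q)

/-- If `H^1` of the subsheaf vanishes, then a family of sections of the subsheaf that is a
coboundary in the ambient sheaf is a coboundary in the subsheaf. -/
lemma exists_coboundary_of_shortExact {S : ShortComplex (Sheaf (Opens.grothendieckTopology T)
    AddCommGrpCat.{u})} (hS : S.ShortExact) (h : Subsingleton (Sheaf.H S.X₁ 1))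
    {ι : Type*} {U : ι → Opens T} (hU : ∀ x : T, ∃ i, x ∈ U i)
    (c : ∀ i j, S.X₁.obj.obj (op (U i ⊓ U j))) (b : ∀ i, S.X₂.obj.obj (op (U i)))
    (hb : ∀ j k, abRes S.X₂ (inf_le_left : U j ⊓ U k ≤ U j) (b j) =
      S.f.hom.app _ (c j k) + abRes S.X₂ (inf_le_right : U j ⊓ U k ≤ U k) (b k)) :
    ∃ s : ∀ i, S.X₁.obj.obj (op (U i)), ∀ i j, S.f.hom.app _ (c i j) =
      S.f.hom.app _ (abRes S.X₁ inf_le_left (s i) - abRes S.X₁ inf_le_right (s j)) := by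
  have hzero : ∀ {V : Opens T} (s : S.X₁.obj.obj (op V)),
      S.g.hom.app _ (S.f.hom.app _ s) = 0 :=
    fun {V} s => congr(($(S.zero)).hom.app (op V) s)
  obtain ⟨q, hq, -⟩ := TopCat.Sheaf.existsUnique_gluing' (C := AddCommGrpCat.{u})
    ⟨S.X₃.obj, S.X₃.property⟩ U ⊤ (fun j => homOfLE le_top)
    (fun x _ => Opens.mem_iSup.2 (hU x)) (fun j => S.g.hom.app _ (b j)) (fun j k => by
      refine (app_abRes S.g inf_le_left (b j)).symm.trans
        (.trans ?_ (app_abRes S.g inf_le_right (b k)))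
      rw [hb, map_add, hzero, zero_add])
  obtain ⟨a, ha⟩ := exists_lift_of_subsingleton_H hS h q
  choose s hs using fun j => exists_of_app_g_eq_zero hS (b j - abRes S.X₂ le_top a) (by
    rw [map_sub, app_abRes, ha, sub_eq_zero]
    exact (hq j).symm)
  refine ⟨s, fun j k => ?_⟩
  rw [map_sub, app_abRes, app_abRes, hs, hs, map_sub, map_sub, abRes_abRes, abRes_abRes, hb]
  abel

/-- If `H^1(F) = 0`, then each additive Čech 1-cocycle of `F` is a coboundary. -/
theorem exists_additive_coboundary (h : Subsingleton (Sheaf.H F 1)) {ι : Type*} {U : ι → Opens T}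
    (hU : ∀ x : T, ∃ i, x ∈ U i) (c : ∀ i j, F.obj.obj (op (U i ⊓ U j)))
    (hc : ∀ i j k (V : Opens T) (hi : V ≤ U i) (hj : V ≤ U j) (hk : V ≤ U k),
      abRes F (le_inf hi hj) (c i j) + abRes F (le_inf hj hk) (c j k) =
        abRes F (le_inf hi hk) (c i k)) :
    ∃ b : ∀ i, F.obj.obj (op (U i)),
      ∀ i j, c i j = abRes F inf_le_left (b i) - abRes F inf_le_right (b j) := by
  choose i hi using hU
  -- a discontinuous splitting of the cocycle: compare with the open set `U (i x)` at each `x`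
  let b : ∀ j, (godement F).obj.obj (op (U j)) := fun j (x : U j) =>
    TopCat.Presheaf.germ F.obj (U j ⊓ U (i x.1)) x.1 ⟨x.2, hi x.1⟩ (c j (i x.1))
  have hb : ∀ j k, abRes (godement F) (inf_le_left : U j ⊓ U k ≤ U j) (b j) =
      (toGodement F).hom.app _ (c j k) +
        abRes (godement F) (inf_le_right : U j ⊓ U k ≤ U k) (b k) := fun j k => by
    refine funext fun x : (U j ⊓ U k : Opens T) => ?_
    have h1 := hc j k (i x.1) (U j ⊓ U k ⊓ U (i x.1)) (inf_le_left.trans inf_le_left)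
      (inf_le_left.trans inf_le_right) inf_le_right
    have h2 := congr_arg
      (TopCat.Presheaf.germ F.obj (U j ⊓ U k ⊓ U (i x.1)) x.1 ⟨x.2, hi x.1⟩) h1
    have h3 : ∀ {V : Opens T} (hV : U j ⊓ U k ⊓ U (i x.1) ≤ V) (s : F.obj.obj (op V)),
        TopCat.Presheaf.germ F.obj (U j ⊓ U k ⊓ U (i x.1)) x.1 ⟨x.2, hi x.1⟩ (abRes F hV s) =
          TopCat.Presheaf.germ F.obj V x.1 (hV ⟨x.2, hi x.1⟩) s := fun hV s =>
      TopCat.Presheaf.germ_res_apply F.obj (homOfLE hV) x.1 ⟨x.2, hi x.1⟩ s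
    rw [map_add, h3, h3, h3] at h2
    exact h2.symm
  obtain ⟨s, hs⟩ := exists_coboundary_of_shortExact (shortExact_godementSequence F) h
    (fun x => ⟨i x, hi x⟩) c b hb
  exact ⟨s, fun j k => toGodement_injective F _ (hs j k)⟩

end Godement

/-! ### Roots in complete rings -/

section Algebra

open Polynomial

/-- If `p` is nilpotent in `A` and `a` is a unit, then `x ↦ a x + p h(x)` is a bijection. -/
lemma existsUnique_perturbation_of_isNilpotent {A : Type*} [CommRing A] {p : A}
    (hp : IsNilpotent p) {a : A} (ha : IsUnit a) (h : A[X]) (y : A) :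
    ∃! x, a * x + p * h.eval x = y := by
  refine existsUnique_of_exists_of_unique ?_ fun x x' hx hx' => ?_
  · obtain ⟨b, hb⟩ := ha.exists_right_inv
    have key : ∀ k : ℕ, ∃ x e, a * x + p * h.eval x + p ^ k * e = y := by
      intro k
      induction k with
      | zero => exact ⟨0, y - p * h.eval 0, by ring⟩
      | succ k ih =>
        obtain ⟨x, e, hx⟩ := ih
        obtain ⟨d, hd⟩ := h.sub_dvd_eval_sub (x + p ^ k * (b * e)) x
        refine ⟨x + p ^ k * (b * e), -(b * e * d), ?_⟩
        rw [sub_eq_iff_eq_add.1 hd, ← hx]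
        linear_combination p ^ k * e * hb
    obtain ⟨n, hn⟩ := hp
    obtain ⟨x, e, hx⟩ := key n
    exact ⟨x, by rw [← hx, hn]; ring⟩
  · obtain ⟨d, hd⟩ := h.sub_dvd_eval_sub x x'
    have hu : IsUnit (a + p * d) :=
      IsNilpotent.isUnit_add_left_of_commute ((Commute.all p d).isNilpotent_mul_right hp) ha
        (Commute.all _ _)
    rw [← sub_eq_zero, ← hu.mul_right_eq_zero]
    linear_combination hx - hx' - p * hd

/-- The reduction map `π : A → A₀` of a `p`-torsion-free ring modulo `p`, such that the equations
`a x + p h(x) = y` with `a` a unit have unique solutions. This holds if `A` is `p`-adically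
complete. -/
structure IsCompleteReduction (p : ℕ) {A A₀ : Type*} [CommRing A] [CommRing A₀]
    (π : A →+* A₀) : Prop where
  surjective : Function.Surjective π
  map_prime : π p = 0
  exists_eq_mul : ∀ x, π x = 0 → ∃ z, x = p * z
  torsionFree : ∀ x : A, p * x = 0 → x = 0
  solve : ∀ (a : A) (_ : IsUnit a) (h : A[X]) (y : A), ∃! x, a * x + p * h.eval x = y

/-- Passage to the limit: if `B` is `p`-torsion-free and `A` is the limit of the rings
`A n = B / p ^ (n + 1)`, then `A → A 0` is the reduction modulo `p` of a complete ring. -/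
theorem isCompleteReduction_of_limit {p : ℕ} {B A : Type*} [CommRing B] [CommRing A]
    {L : ℕ → Type*} [∀ n, CommRing (L n)] (t : ∀ n, L (n + 1) →+* L n) (β : ∀ n, B →+* L n)
    (hβ : ∀ n, Function.Surjective (β n))
    (hker : ∀ n b, β n b = 0 ↔ ∃ c, b = (p : B) ^ (n + 1) * c)
    (htβ : ∀ n b, t n (β (n + 1) b) = β n b) (hB : ∀ b : B, p * b = 0 → b = 0)
    (π : ∀ n, A →+* L n) (ht : ∀ n a, t n (π (n + 1) a) = π n a)
    (hinj : ∀ a b, (∀ n, π n a = π n b) → a = b)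
    (hex : ∀ a : ∀ n, L n, (∀ n, t n (a (n + 1)) = a n) → ∃ x, ∀ n, π n x = a n) :
    IsCompleteReduction p (π 0) := by
  have hnil : ∀ n, IsNilpotent ((p : ℕ) : L n) := fun n => ⟨n + 1, by
    have := (hker n ((p : B) ^ (n + 1))).2 ⟨1, (mul_one _).symm⟩
    simpa using this⟩
  have hann : ∀ n (x : L (n + 1)), p * x = 0 → t n x = 0 := fun n x hx => by
    obtain ⟨b, rfl⟩ := hβ (n + 1) x
    rw [htβ, hker]
    obtain ⟨c, hc⟩ := (hker (n + 1) (p * b)).1 (by rw [map_mul, map_natCast, hx])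
    refine ⟨c, sub_eq_zero.1 (hB _ ?_)⟩
    rw [mul_sub, hc]; ring
  refine ⟨fun x => ?_, ?_, fun x hx => ?_, fun x hx => ?_, fun a ha h y => ?_⟩
  · obtain ⟨b, rfl⟩ := hβ 0 x
    obtain ⟨y, hy⟩ := hex (fun n => β n b) fun n => htβ n b
    exact ⟨y, hy 0⟩
  · have := (hker 0 (p : B)).2 ⟨1, by ring⟩
    simpa using this
  · have hz : ∀ n, ∃ z, π n x = p * z := fun n => by
      obtain ⟨b, hb⟩ := hβ n (π n x)
      have h0 : ∀ k, π k x = β k b → π 0 x = β 0 b := fun k => by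
        induction k with
        | zero => exact id
        | succ k ih => exact fun h => ih (by rw [← ht, h, htβ])
      obtain ⟨c, hc⟩ := (hker 0 b).1 ((h0 n hb.symm).symm.trans hx)
      exact ⟨β n c, by rw [← hb, hc]; simp⟩
    choose z hz using hz
    -- the quotient by `p` is well defined only one level below
    obtain ⟨w, hw⟩ := hex (fun n => t n (z (n + 1))) fun n => by
      rw [← sub_eq_zero, ← map_sub]
      apply hann
      rw [mul_sub, ← hz, ← map_natCast (t (n + 1)), ← map_mul, ← hz, ht, sub_self]
    refine ⟨w, hinj _ _ fun n => ?_⟩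
    rw [map_mul, map_natCast, hw, ← ht, hz, map_mul, map_natCast]
  · refine hinj _ _ fun n => ?_
    rw [map_zero, ← ht]
    apply hann
    rw [← map_natCast (π (n + 1)), ← map_mul, hx, map_zero]
  · have hs := fun n => existsUnique_perturbation_of_isNilpotent (hnil n) (ha.map (π n))
      (h.map (π n)) (π n y)
    choose x hx hx' using hs
    dsimp only at hx hx'
    obtain ⟨x₀, h₀⟩ := hex x fun n => hx' n _ (by
      have h1 := congr_arg (t n) (hx (n + 1))
      rw [map_add, map_mul, map_mul, map_natCast, ht, ht, ← eval_map_apply, map_map] at h1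
      rw [← h1]
      congr 4
      ext b
      exact (ht n b).symm)
    refine ⟨x₀, hinj _ _ fun n => ?_, fun x₁ h₁ => hinj _ _ fun n => ?_⟩
    · rw [map_add, map_mul, map_mul, map_natCast, ← eval_map_apply, h₀, hx]
    · rw [h₀]
      apply hx'
      rw [← h₁, map_add, map_mul, map_mul, map_natCast, ← eval_map_apply]

/-- The binomial expansion up to order two; the remainder is a polynomial independent of the ring
and of `y`. -/
lemma exists_one_add_pow_eq (n : ℕ) : ∃ g : ℤ[X], ∀ {A : Type u} [CommRing A] (y : A),
    (1 + y) ^ n = 1 + n * y + (n.choose 2 : ℕ) * y ^ 2 + y ^ 3 * aeval y g := by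
  induction n with
  | zero => exact ⟨0, fun y => by simp⟩
  | succ n ih =>
    obtain ⟨g, hg⟩ := ih
    refine ⟨((n.choose 2 : ℕ) : ℤ[X]) + g + X * g, fun y => ?_⟩
    have : (n + 1).choose 2 = n + n.choose 2 := by
      rw [Nat.choose_succ_succ' n 1, Nat.choose_one_right]
    rw [pow_succ, hg, this]
    simp only [map_add, map_mul, map_natCast, aeval_X]
    push_cast
    ring

variable {p : ℕ} {A A₀ : Type u} [CommRing A] [CommRing A₀] {π : A →+* A₀}

namespace IsCompleteReduction

lemma isUnit_one_add (h : IsCompleteReduction p π) (x : A) : IsUnit (1 + p * x) := by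
  obtain ⟨z, hz, -⟩ := h.solve 1 isUnit_one (C x * X) 1
  refine IsUnit.of_mul_eq_one z ?_
  rw [eval_mul, eval_C, eval_X] at hz
  linear_combination hz

lemma isUnit_of_map (h : IsCompleteReduction p π) {x : A} (hx : IsUnit (π x)) : IsUnit x := by
  obtain ⟨b, hb⟩ := hx.exists_right_inv
  obtain ⟨y, rfl⟩ := h.surjective b
  obtain ⟨z, hz⟩ := h.exists_eq_mul (x * y - 1) (by rw [map_sub, map_mul, hb, map_one, sub_self])
  refine isUnit_of_mul_isUnit_left (y := y) ?_
  rw [sub_eq_iff_eq_add'.1 hz]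
  exact h.isUnit_one_add z

lemma exists_eq_add_mul (h : IsCompleteReduction p π) {x y : A} (hxy : π x = π y) :
    ∃ z, x = y + p * z := by
  obtain ⟨z, hz⟩ := h.exists_eq_mul (x - y) (by rw [map_sub, hxy, sub_self])
  exact ⟨z, by rw [← hz]; ring⟩

lemma mul_cancel (h : IsCompleteReduction p π) {x y : A} (hxy : p * x = p * y) : x = y :=
  sub_eq_zero.1 (h.torsionFree _ (by rw [mul_sub, hxy, sub_self]))

lemma isUnit_natCast (h : IsCompleteReduction p π) {n : ℕ} (hn : n.Coprime p) :
    IsUnit (n : A) := by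
  have := (Nat.isCoprime_iff_coprime.2 hn)
  obtain ⟨a, b, hab⟩ := this
  have h1 : (n : A) * (a : A) = 1 + p * (-b : A) := by
    have := congr_arg (Int.cast : ℤ → A) hab
    push_cast at this
    linear_combination this
  exact isUnit_of_mul_isUnit_left (h1 ▸ h.isUnit_one_add _)

/-- For `p` odd, the `p`-th power is a bijection from `1 + p A` to `1 + p² A`, because
`(1 + p x) ^ p = 1 + p² (x + p h(x))`. -/
lemma existsUnique_pow_prime (h : IsCompleteReduction p π) (hp : p.Prime) (hp2 : p ≠ 2) (y : A) :
    ∃! x, (1 + p * x) ^ p = 1 + p ^ 2 * y := by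
  obtain ⟨g, hg⟩ := exists_one_add_pow_eq.{u} p
  obtain ⟨c, hc⟩ : p ∣ p.choose 2 := hp.dvd_choose_self two_ne_zero
    (lt_of_le_of_ne hp.two_le hp2.symm)
  have hiff : ∀ x : A, (1 + p * x) ^ p = 1 + p ^ 2 * y ↔
      1 * x + p * ((C (c : A) * X ^ 2 +
        X ^ 3 * (g.map (Int.castRingHom A)).comp (C (p : A) * X)).eval x) = y := fun x => by
    have h1 : aeval (p * x) g = (g.map (Int.castRingHom A)).eval (p * x) := by
      rw [aeval_def, Polynomial.eval_map]; rfl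
    simp only [eval_add, eval_mul, eval_C, eval_pow, eval_X, eval_comp]
    rw [hg, hc, h1]
    push_cast
    constructor
    · intro H
      apply h.mul_cancel
      apply h.mul_cancel
      linear_combination H
    · intro H
      linear_combination (p : A) ^ 2 * H
  simp only [hiff]
  exact h.solve 1 isUnit_one _ y

/-- For `n` prime to `p`, the `n`-th power is a bijection from `1 + p A` to itself, because
`(1 + p x) ^ n = 1 + p (n x + p h(x))`. -/
lemma existsUnique_pow_coprime (h : IsCompleteReduction p π) {n : ℕ} (hn : n.Coprime p) (y : A) :
    ∃! x, (1 + p * x) ^ n = 1 + p * y := by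
  obtain ⟨g, hg⟩ := exists_one_add_pow_eq.{u} n
  have hiff : ∀ x : A, (1 + p * x) ^ n = 1 + p * y ↔
      n * x + p * ((C ((n.choose 2 : ℕ) : A) * X ^ 2 +
        C (p : A) * X ^ 3 * (g.map (Int.castRingHom A)).comp (C (p : A) * X)).eval x) = y :=
    fun x => by
    have h1 : aeval (p * x) g = (g.map (Int.castRingHom A)).eval (p * x) := by
      rw [aeval_def, Polynomial.eval_map]; rfl
    simp only [eval_add, eval_mul, eval_C, eval_pow, eval_X, eval_comp]
    rw [hg, h1]
    constructor
    · intro H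
      apply h.mul_cancel
      linear_combination H
    · intro H
      linear_combination (p : A) * H
  simp only [hiff]
  exact h.solve n (h.isUnit_natCast hn) _ y

/-- For `p` odd, the group `1 + p A` has no torsion of prime order. -/
lemma eq_one_of_pow_eq_one (h : IsCompleteReduction p π) (hp : p.Prime) (hp2 : p ≠ 2) {l : ℕ}
    (hl : l.Prime) {x : A} (hx : π x = 1) (hxl : x ^ l = 1) : x = 1 := by
  obtain ⟨z, rfl⟩ := h.exists_eq_add_mul (hx.trans (map_one π).symm)
  suffices z = 0 by rw [this, mul_zero, add_zero]
  by_cases hlp : l = p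
  · subst hlp
    refine (h.existsUnique_pow_prime hp hp2 0).unique ?_ ?_
    · rw [hxl, mul_zero, add_zero]
    · simp
  · refine (h.existsUnique_pow_coprime ((Nat.coprime_primes hl hp).2 hlp) 0).unique ?_ ?_
    · rw [hxl, mul_zero, add_zero]
    · simp

end IsCompleteReduction

end Algebra

/-! ### Sections of the thickenings over affine open sets -/

section Thickenings

/-- The kernel of the base change of a surjective ring homomorphism. -/
lemma mem_map_ker_of_isPushout {R S R' S' : CommRingCat.{u}} {a : R ⟶ S} {b : R ⟶ R'}
    {c : S ⟶ S'} {d : R' ⟶ S'} (h : IsPushout a b c d) (hb : Function.Surjective b) {x : S}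
    (hx : c x = 0) : x ∈ (RingHom.ker b.hom).map a.hom := by
  let I := (RingHom.ker b.hom).map a.hom
  let q : S ⟶ CommRingCat.of (S ⧸ I) := CommRingCat.ofHom (Ideal.Quotient.mk I)
  let g : {g : R →+* S ⧸ I // RingHom.ker b.hom ≤ RingHom.ker g} :=
    ⟨(Ideal.Quotient.mk I).comp a.hom, fun y hy =>
      Ideal.Quotient.eq_zero_iff_mem.2 (Ideal.mem_map_of_mem _ hy)⟩
  let r : R' ⟶ CommRingCat.of (S ⧸ I) := CommRingCat.ofHom (RingHom.liftOfSurjective b.hom hb g)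
  have hw : a ≫ q = b ≫ r := by
    ext y
    exact (RingHom.liftOfRightInverse_comp_apply b.hom _ (Function.rightInverse_surjInv hb)
      g y).symm
  have : q x = h.desc q r hw (c x) := congr($(h.inl_desc q r hw).hom x).symm
  rw [hx, map_zero] at this
  exact Ideal.Quotient.eq_zero_iff_mem.1 this

variable {p : ℕ} [Fact p.Prime]

lemma modPow_appTop_surjective (n : ℕ) : Function.Surjective ((modPow p n).appLE ⊤ ⊤ le_rfl) := by
  have h := Scheme.Hom.app_surjective (modPow p n) ⊤ (isAffineOpen_top _)
  rwa [Scheme.Hom.app_eq_appLE] at h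

lemma exists_eq_pow_mul_of_modPow_eq_zero (n : ℕ) (x : Γ(Spec (.of ℤ_[p]), ⊤))
    (hx : (modPow p n).appLE ⊤ ⊤ le_rfl x = 0) : ∃ y, x = (p : Γ(Spec (.of ℤ_[p]), ⊤)) ^ n * y := by
  let e := (Scheme.ΓSpecIso (.of ℤ_[p])).commRingCatIsoToRingEquiv
  have h1 : PadicInt.toZModPow n (e x) = 0 := by
    have := congr($(Scheme.ΓSpecIso_naturality
      (CommRingCat.ofHom (PadicInt.toZModPow (p := p) n))) x)
    refine this.symm.trans ?_
    change (Scheme.ΓSpecIso _).hom ((modPow p n).app ⊤ x) = 0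
    rw [Scheme.Hom.app_eq_appLE]
    exact (congr_arg _ hx).trans (map_zero (Scheme.ΓSpecIso _).hom.hom)
  have h2 : e x ∈ Ideal.span {(p : ℤ_[p]) ^ n} := by
    rw [← PadicInt.ker_toZModPow]
    exact h1
  obtain ⟨y, hy⟩ := Ideal.mem_span_singleton.1 h2
  refine ⟨e.symm y, e.injective ?_⟩
  rw [map_mul, e.apply_symm_apply, map_pow, map_natCast, hy]

variable {X : Scheme.{0}} (f : X ⟶ Spec (.of ℤ_[p]))

/-- On affine open sets, restriction of functions to `X_{p^n}` is surjective. -/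
lemma thickening_appLE_surjective (n : ℕ) {W : X.Opens} (hW : IsAffineOpen W)
    {V : (thickening f n).Opens} (hV : V = thickeningι f n ⁻¹ᵁ W) :
    Function.Surjective ((thickeningι f n).appLE W V hV.le) := by
  subst hV
  have h := Scheme.Hom.app_surjective (thickeningι f n) W hW
  rwa [Scheme.Hom.app_eq_appLE] at h

/-- On affine open sets, the kernel of the restriction of functions to `X_{p^n}` is generated by
`p ^ n`. -/
lemma thickening_appLE_eq_zero_iff (n : ℕ) {W : X.Opens} (hW : IsAffineOpen W)
    {V : (thickening f n).Opens} (hV : V = thickeningι f n ⁻¹ᵁ W) (x : Γ(X, W)) :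
    (thickeningι f n).appLE W V hV.le x = 0 ↔ ∃ y, x = (p : Γ(X, W)) ^ n * y := by
  have H : IsPullback (thickeningι f n) (Limits.pullback.snd f (modPow p n)) f (modPow p n) :=
    IsPullback.of_hasPullback _ _
  have hV' : V = thickeningι f n ⁻¹ᵁ W ⊓ Limits.pullback.snd f (modPow p n) ⁻¹ᵁ ⊤ := by
    rw [hV]; simp
  have hpush := (isIso_pushoutSection_iff H (US := ⊤) (UT := ⊤) (UX := W) le_rfl le_top hV').1
    (isIso_pushoutSection_of_isAffineOpen H le_rfl le_top hV' (isAffineOpen_top _)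
      (isAffineOpen_top _) hW)
  constructor
  · intro hx
    have h1 := mem_map_ker_of_isPushout hpush (modPow_appTop_surjective n) hx
    have h2 : (RingHom.ker ((modPow p n).appLE ⊤ ⊤ le_rfl).hom).map (f.appLE ⊤ W le_top).hom ≤
        Ideal.span {(p : Γ(X, W)) ^ n} := by
      rw [Ideal.map_le_iff_le_comap]
      intro y hy
      obtain ⟨z, rfl⟩ := exists_eq_pow_mul_of_modPow_eq_zero n y hy
      rw [Ideal.mem_comap, map_mul, map_pow, map_natCast]
      exact Ideal.mul_mem_right _ _ (Ideal.mem_span_singleton_self _)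
    exact Ideal.mem_span_singleton.1 (h2 h1)
  · rintro ⟨y, rfl⟩
    have h0 : (((p ^ n : ℕ) : ZMod (p ^ n)) : ZMod (p ^ n)) = 0 := ZMod.natCast_self _
    have h1 := congr_arg ((Limits.pullback.snd f (modPow p n)).appLE ⊤ V le_top)
      (congr_arg (Scheme.ΓSpecIso (.of (ZMod (p ^ n)))).inv h0)
    rw [map_natCast, map_natCast, map_zero, map_zero] at h1
    rw [map_mul, map_pow, map_natCast, ← Nat.cast_pow, h1, zero_mul]

lemma eq_zero_of_flat {R S : Type*} [CommRing R] [CommRing S] {φ : R →+* S} (hφ : φ.Flat) {r : R}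
    (hr : ∀ y, r * y = 0 → y = 0) {x : S} (hx : φ r * x = 0) : x = 0 := by
  algebraize [φ]
  have h : IsSMulRegular R r := isSMulRegular_iff_right_eq_zero_of_smul.2 hr
  exact isSMulRegular_iff_right_eq_zero_of_smul.1 (h.of_flat (S := S)) x hx

/-- Functions on a flat scheme over `ℤ_p` are `p`-torsion free. -/
lemma eq_zero_of_prime_mul_eq_zero [Flat f] {W : X.Opens} (hW : IsAffineOpen W) (x : Γ(X, W))
    (hx : (p : Γ(X, W)) * x = 0) : x = 0 := by
  have h1 : (f.appLE ⊤ W le_top).hom.Flat :=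
    (HasRingHomProperty.iff_appLE (P := @Flat)).1 inferInstance ⟨⊤, isAffineOpen_top _⟩ ⟨W, hW⟩ _
  let e := (Scheme.ΓSpecIso (.of ℤ_[p])).commRingCatIsoToRingEquiv
  refine eq_zero_of_flat h1 (r := p) (fun y hy => ?_) (by rwa [map_natCast])
  apply e.injective
  have h3 := congr_arg e hy
  rw [map_mul, map_natCast, map_zero] at h3
  rw [map_zero]
  exact (mul_eq_zero.1 h3).resolve_left (Nat.cast_ne_zero.2 (Fact.out : p.Prime).ne_zero)

lemma retraction_preimage (n : ℕ) (W : X.Opens) :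
    (Opens.map (retraction f n)).obj (thickeningι f 1 ⁻¹ᵁ W) = thickeningι f (n + 1) ⁻¹ᵁ W := by
  ext x
  obtain ⟨y, rfl⟩ := (specialFiberHomeo f n).surjective x
  have h1 : retraction f n (specialFiberHomeo f n y) = y :=
    (specialFiberHomeo f n).symm_apply_apply y
  have h2 : thickeningι f (n + 1) (specialFiberHomeo f n y) = thickeningι f 1 y := by
    rw [← transition_ι f (Nat.le_add_left 1 n)]
    rfl
  change thickeningι f 1 (retraction f n (specialFiberHomeo f n y)) ∈ W ↔
    thickeningι f (n + 1) (specialFiberHomeo f n y) ∈ W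
  rw [h1, h2]

end Thickenings

/-! ### Sections of the formal completion over affine open sets -/

section Completion

/-- Elements of a sequential limit of sheaves of rings, over an open set, are determined by their
components. -/
lemma limit_ext {T : TopCat.{u}} {S : ℕ → RingSheaf T} (t : ∀ n, S (n + 1) ⟶ S n) (U : Opens T)
    {a b : (Limits.limit (Functor.ofOpSequence t)).obj.obj (op U)}
    (h : ∀ n, (Limits.limit.π (Functor.ofOpSequence t) (op n)).hom.app (op U) a =
      (Limits.limit.π (Functor.ofOpSequence t) (op n)).hom.app (op U) b) : a = b := by
  let ev := sheafToPresheaf (Opens.grothendieckTopology T) CommRingCat.{u} ⋙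
    (evaluation _ _).obj (op U)
  exact Limits.Concrete.isLimit_ext _
    (Limits.isLimitOfPreserves ev (Limits.limit.isLimit (Functor.ofOpSequence t))) a b
    fun n => h n.unop

lemma limit_π_succ {T : TopCat.{u}} {S : ℕ → RingSheaf T} (t : ∀ n, S (n + 1) ⟶ S n) (U : Opens T)
    (n : ℕ) (a : (Limits.limit (Functor.ofOpSequence t)).obj.obj (op U)) :
    (t n).hom.app (op U) ((Limits.limit.π (Functor.ofOpSequence t) (op (n + 1))).hom.app (op U) a) =
      (Limits.limit.π (Functor.ofOpSequence t) (op n)).hom.app (op U) a := by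
  have h := Limits.limit.w (Functor.ofOpSequence t) (homOfLE (Nat.le_add_right n 1)).op
  rw [Functor.ofOpSequence_map_homOfLE_succ] at h
  exact congr(($h).hom.app (op U) a)

/-- Compatible families define elements of a sequential limit of sheaves of rings. -/
lemma exists_limit_lift {T : TopCat.{u}} {S : ℕ → RingSheaf T} (t : ∀ n, S (n + 1) ⟶ S n)
    (U : Opens T) (a : ∀ n, (S n).obj.obj (op U))
    (ha : ∀ n, (t n).hom.app (op U) (a (n + 1)) = a n) :
    ∃ x, ∀ n, (Limits.limit.π (Functor.ofOpSequence t) (op n)).hom.app (op U) x = a n := by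
  let ev := (sheafToPresheaf (Opens.grothendieckTopology T) CommRingCat.{u} ⋙
    (evaluation _ _).obj (op U)) ⋙ forget CommRingCat
  let c : Limits.Cone (Functor.ofOpSequence t ⋙ ev) :=
    { pt := PUnit
      π := NatTrans.ofOpSequence (fun n => ↾fun _ => a n) fun n => by
        ext x
        refine (ha n).symm.trans ?_
        change _ = ev.map ((Functor.ofOpSequence t).map _) (a (n + 1))
        rw [Functor.ofOpSequence_map_homOfLE_succ]
        rfl }
  let hl := Limits.isLimitOfPreserves ev (Limits.limit.isLimit (Functor.ofOpSequence t))
  exact ⟨hl.lift c PUnit.unit, fun n => congr($(hl.fac c (op n)) PUnit.unit)⟩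

lemma IsCompleteReduction.comp {p : ℕ} {A A₀ A₁ : Type*} [CommRing A] [CommRing A₀] [CommRing A₁]
    {π : A →+* A₀} (h : IsCompleteReduction p π) (e : A₀ →+* A₁) (he : Function.Bijective e) :
    IsCompleteReduction p (e.comp π) where
  surjective := he.2.comp h.surjective
  map_prime := by rw [RingHom.comp_apply, h.map_prime, map_zero]
  exists_eq_mul x hx := h.exists_eq_mul x (he.1 (hx.trans (map_zero e).symm))
  torsionFree := h.torsionFree
  solve := h.solve

lemma appLE_bijective_of_eq_id {Y : Scheme.{u}} {g : Y ⟶ Y} (hg : g = 𝟙 Y) {V V' : Y.Opens}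
    (h : V' ≤ g ⁻¹ᵁ V) (hV : V = V') : Function.Bijective (g.appLE V V' h) := by
  subst hg hV
  have : (𝟙 Y : Y ⟶ Y).appLE V V h = 𝟙 _ := by
    rw [Scheme.Hom.appLE, Scheme.Hom.id_app]
    exact (Category.id_comp _).trans (Y.presheaf.map_id _)
  rw [this]
  exact Function.bijective_id

variable {p : ℕ} [Fact p.Prime] {X : Scheme.{0}} (f : X ⟶ Spec (.of ℤ_[p]))

/-- Over the open set of `X_p` cut out by an affine open set of `X`, the projection from the
structure sheaf of the formal completion to that of `X_p` is the reduction modulo `p` of a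
complete ring. -/
theorem isCompleteReduction_comorphism [Flat f] {W : X.Opens} (hW : IsAffineOpen W) :
    IsCompleteReduction p
      (comorphism (specialFiberInclusion f) (thickeningι f 1 ⁻¹ᵁ W)) := by
  let U : Opens (thickening f 1).toPresheafedSpace.carrier := thickeningι f 1 ⁻¹ᵁ W
  have h := isCompleteReduction_of_limit (p := p) (B := Γ(X, W))
    (A := (completedSheaf f).obj.obj (op U)) (L := fun n => (levelSheaf f n).obj.obj (op U))
    (fun n => ((levelMap f n).hom.app (op U)).hom)
    (fun n => ((thickeningι f (n + 1)).appLE W _ (retraction_preimage f n W).le).hom)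
    (fun n => thickening_appLE_surjective f (n + 1) hW (retraction_preimage f n W))
    (fun n b => thickening_appLE_eq_zero_iff f (n + 1) hW (retraction_preimage f n W) b)
    (fun n b => by
      have h1 := Scheme.Hom.appLE_comp_appLE (transition f (Nat.le_succ (n + 1)))
        (thickeningι f (n + 2)) W ((Opens.map (retraction f (n + 1))).obj U)
        ((Opens.map (retraction f n)).obj U) (retraction_preimage f (n + 1) W).le
        (fun x hx => by
          change retraction f (n + 1) (transition f (Nat.le_succ (n + 1)) x) ∈ U
          rw [retraction_transition]
          exact hx)
      simp only [transition_ι] at h1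
      exact congr($h1 b))
    (eq_zero_of_prime_mul_eq_zero f hW)
    (fun n => ((Limits.limit.π (Functor.ofOpSequence (levelMap f)) (op n)).hom.app (op U)).hom)
    (fun n a => limit_π_succ (levelMap f) U n a)
    (fun a b hab => limit_ext (levelMap f) U hab)
    (fun a ha => exists_limit_lift (levelMap f) U a ha)
  refine h.comp ((transition f le_rfl).appLE ((Opens.map (retraction f 0)).obj U) U _).hom
    (appLE_bijective_of_eq_id ?_ _ (retraction_preimage f 0 W))
  rw [← cancel_mono (thickeningι f 1), transition_ι, Category.id_comp]

end Completion

/-! ### Roots of liftable classes -/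

section Roots

/-- The vanishing of `H^1` for the additive group of the structure sheaf, stated with the
restriction homomorphisms of rings. -/
lemma exists_ring_coboundary {Z : RingedSpace.{u}} (h : Subsingleton (H1 Z)) {ι : Type*}
    {U : ι → Opens Z.carrier} (hU : ∀ x : Z.carrier, ∃ i, x ∈ U i)
    (c : ∀ i j, (structureSheaf Z).obj.obj (op (U i ⊓ U j)))
    (hc : ∀ i j k (V : Opens Z.carrier) (hi : V ≤ U i) (hj : V ≤ U j) (hk : V ≤ U k),
      ringRes _ (le_inf hi hj) (c i j) + ringRes _ (le_inf hj hk) (c j k) =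
        ringRes _ (le_inf hi hk) (c i k)) :
    ∃ b : ∀ i, (structureSheaf Z).obj.obj (op (U i)),
      ∀ i j, c i j = ringRes _ inf_le_left (b i) - ringRes _ inf_le_right (b j) :=
  exists_additive_coboundary (F := structureSheafAb Z) h hU c hc

/-- The product of a cocycle with the coboundary of a family of units is a cocycle. -/
lemma IsCocycle.twist {T : TopCat.{u}} {R : RingSheaf T} {ι : Type u} {U : ι → Opens T}
    {m : ∀ i j, R.obj.obj (op (U i ⊓ U j))} (hm : IsCocycle R U m)
    {w w' : ∀ i, R.obj.obj (op (U i))} (hw : ∀ i, w i * w' i = 1) :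
    IsCocycle R U (fun i j => m i j * ringRes R inf_le_right (w j) *
      ringRes R inf_le_left (w' i)) where
  one i := by
    have := congr_arg (ringRes R (inf_le_left : U i ⊓ U i ≤ U i)) (hw i)
    rw [map_mul, map_one] at this
    rw [hm.one, one_mul, this]
  mul i j k V hi hj hk := by
    have h1 := congr_arg (ringRes R hj) (hw j)
    rw [map_mul, map_one] at h1
    simp only [map_mul, ringRes_ringRes]
    rw [← hm.mul i j k V hi hj hk]
    linear_combination ringRes R (le_inf hi hj) (m i j) * ringRes R (le_inf hj hk) (m j k) *
      ringRes R hk (w k) * ringRes R hi (w' i) * h1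

lemma IsCompleteReduction.comorphismLE {p : ℕ} {Z W : RingedSpace.{u}} {g : Z ⟶ W}
    {U : Opens W.carrier} (h : IsCompleteReduction p (comorphism g U)) {V : Opens Z.carrier}
    (hV : V = (Opens.map g.hom.base).obj U) :
    IsCompleteReduction p (PicardLift.comorphismLE g hV.le) := by
  subst hV
  have : PicardLift.comorphismLE g (le_refl ((Opens.map g.hom.base).obj U)) = comorphism g U :=
    RingHom.ext fun x => ringRes_self _ _
  rwa [this]

variable {p : ℕ} {Z W : RingedSpace.{u}} {g : Z ⟶ W} {ι : Type u} {B : ι → Opens W.carrier}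

/-- Liftings `e` of a cocycle `q` whose `l`-th powers form a cocycle are themselves a cocycle,
because `1 + p A` has no `l`-torsion. -/
lemma isCocycle_of_pow_eq (hp : p.Prime) (hp2 : p ≠ 2)
    (hB : ∀ i j, IsCompleteReduction p (comorphism g (B i ⊓ B j)))
    (hB' : ∀ i j k, IsCompleteReduction p (comorphism g (B i ⊓ B j ⊓ B k)))
    {l : ℕ} (hl : l.Prime)
    {q : ∀ i j, (structureSheaf Z).obj.obj
      (op ((Opens.map g.hom.base).obj (B i) ⊓ (Opens.map g.hom.base).obj (B j)))}
    (hq : IsCocycle (structureSheaf Z) (fun i => (Opens.map g.hom.base).obj (B i)) q)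
    {m e : ∀ i j, (structureSheaf W).obj.obj (op (B i ⊓ B j))}
    (hm : IsCocycle (structureSheaf W) B m) (he : ∀ i j, e i j ^ l = m i j)
    (heq : ∀ i j, comorphismLE g (map_inf_le g _ _) (e i j) = q i j) :
    IsCocycle (structureSheaf W) B e where
  one i := by
    refine ((hB i i).comorphismLE rfl).eq_one_of_pow_eq_one hp hp2 hl ?_ ?_
    · exact (heq i i).trans (hq.one i)
    · rw [he, hm.one]
  mul i j k V hi hj hk := by
    have h := (hB' i j k).comorphismLE (V := (Opens.map g.hom.base).obj (B i ⊓ B j ⊓ B k)) rfl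
    let Ai : B i ⊓ B j ⊓ B k ≤ B i := inf_le_left.trans inf_le_left
    let Aj : B i ⊓ B j ⊓ B k ≤ B j := inf_le_left.trans inf_le_right
    let Ak : B i ⊓ B j ⊓ B k ≤ B k := inf_le_right
    let x := ringRes (structureSheaf W) (le_inf Ai Aj) (e i j)
    let y := ringRes (structureSheaf W) (le_inf Aj Ak) (e j k)
    let z := ringRes (structureSheaf W) (le_inf Ai Ak) (e i k)
    let π := comorphismLE g (le_refl ((Opens.map g.hom.base).obj (B i ⊓ B j ⊓ B k)))
    have hpi : ∀ {i' j' : ι} (hi' : B i ⊓ B j ⊓ B k ≤ B i') (hj' : B i ⊓ B j ⊓ B k ≤ B j'),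
        π (ringRes (structureSheaf W) (le_inf hi' hj') (e i' j')) =
        ringRes (structureSheaf Z) (le_inf ((Opens.map g.hom.base).monotone hi')
          ((Opens.map g.hom.base).monotone hj')) (q i' j') := fun hi' hj' => by
      rw [comorphismLE_ringRes, ← heq, ringRes_comorphismLE]
    have h1 : x * y = z := by
      have hz : IsUnit z := h.isUnit_of_map (by
        rw [hpi Ai Ak]
        exact IsUnit.of_mul_eq_one _ (hq.mul_symm i k ((Opens.map g.hom.base).monotone Ai)
          ((Opens.map g.hom.base).monotone Ak)))
      obtain ⟨z', hz'⟩ := hz.exists_right_inv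
      suffices x * y * z' = 1 by
        linear_combination z * this - x * y * hz'
      refine h.eq_one_of_pow_eq_one hp hp2 hl ?_ ?_
      · have hxy : π (x * y) = π z := by
          rw [map_mul, hpi Ai Aj, hpi Aj Ak, hpi Ai Ak]
          exact hq.mul i j k _ ((Opens.map g.hom.base).monotone Ai)
            ((Opens.map g.hom.base).monotone Aj) ((Opens.map g.hom.base).monotone Ak)
        rw [map_mul, hxy, ← map_mul, hz', map_one]
      · have hxy : (x * y) ^ l = z ^ l := by
          rw [mul_pow, ← map_pow, ← map_pow, ← map_pow, he, he, he]
          exact hm.mul i j k _ Ai Aj Ak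
        rw [mul_pow, hxy, ← mul_pow, hz', one_pow]
    have h2 := congr_arg (ringRes (structureSheaf W) (le_inf (le_inf hi hj) hk)) h1
    rw [map_mul, ringRes_ringRes, ringRes_ringRes, ringRes_ringRes] at h2
    exact h2

/-- If the `l`-th power of a cocycle `q` lifts to a cocycle `m`, then so does `q`. For `l ≠ p` this
holds since the `l`-th power is bijective on `1 + p A`. For `l = p` the liftings of the `q i j` have
`p`-th powers that differ from the `m i j` by elements of `1 + p A`; modulo `1 + p² A`, these form a
cocycle of `(1 + p A) / (1 + p² A) ≅ A / p`, which is a coboundary because `H^1 = 0`. After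
modification of `m`, the differences lie in `1 + p² A` and have unique `p`-th roots in `1 + p A`. -/
theorem exists_lift_of_pow_lift (hp : p.Prime) (hp2 : p ≠ 2) (hH : Subsingleton (H1 Z))
    (hB₁ : ∀ i, IsCompleteReduction p (comorphism g (B i)))
    (hB : ∀ i j, IsCompleteReduction p (comorphism g (B i ⊓ B j)))
    (hB' : ∀ i j k, IsCompleteReduction p (comorphism g (B i ⊓ B j ⊓ B k)))
    (hcov : ∀ x : Z.carrier, ∃ i, x ∈ (Opens.map g.hom.base).obj (B i))
    {l : ℕ} (hl : l.Prime)
    {q : ∀ i j, (structureSheaf Z).obj.obj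
      (op ((Opens.map g.hom.base).obj (B i) ⊓ (Opens.map g.hom.base).obj (B j)))}
    (hq : IsCocycle (structureSheaf Z) (fun i => (Opens.map g.hom.base).obj (B i)) q)
    {m : ∀ i j, (structureSheaf W).obj.obj (op (B i ⊓ B j))}
    (hm : IsCocycle (structureSheaf W) B m)
    (hmq : ∀ i j, comorphismLE g (map_inf_le g _ _) (m i j) = q i j ^ l) :
    ∃ e : ∀ i j, (structureSheaf W).obj.obj (op (B i ⊓ B j)),
      IsCocycle (structureSheaf W) B e ∧
        ∀ i j, comorphismLE g (map_inf_le g _ _) (e i j) = q i j := by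
  have h₂ : ∀ i j, IsCompleteReduction p (comorphismLE g (map_inf_le g (B i) (B j))) :=
    fun i j => (hB i j).comorphismLE rfl
  -- arbitrary liftings of the `q i j`, and their deviation `1 + p y` from roots of `m`
  choose e he using fun i j => (h₂ i j).surjective (q i j)
  have hu : ∀ i j, IsUnit (e i j) := fun i j => (h₂ i j).isUnit_of_map (by
    rw [he]
    have := hq.mul_symm i j inf_le_left inf_le_right
    rw [ringRes_self] at this
    exact IsUnit.of_mul_eq_one _ this)
  have hy : ∀ i j, ∃ y : (structureSheaf W).obj.obj (op (B i ⊓ B j)), m i j =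
      e i j ^ l * (1 + (p : (structureSheaf W).obj.obj (op (B i ⊓ B j))) * y) := fun i j => by
    obtain ⟨z, hz⟩ := (h₂ i j).exists_eq_add_mul
      (show comorphismLE g (map_inf_le g _ _) (m i j) =
        comorphismLE g (map_inf_le g _ _) (e i j ^ l) by rw [hmq, map_pow, he])
    obtain ⟨d, hd⟩ := ((hu i j).pow l).exists_right_inv
    exact ⟨d * z, by rw [hz]; linear_combination -(p * z) * hd⟩
  choose y hy using hy
  have hmod : ∀ i j (x : (structureSheaf W).obj.obj (op (B i ⊓ B j))),
      comorphismLE g (map_inf_le g _ _)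
        (e i j * (1 + (p : (structureSheaf W).obj.obj (op (B i ⊓ B j))) * x)) = q i j :=
    fun i j x => by
    rw [map_mul, map_add, map_mul, (h₂ i j).map_prime, he, map_one, zero_mul, add_zero, mul_one]
  by_cases hlp : l = p
  · subst hlp
    -- modulo `p`, the deviations form an additive cocycle
    let c : ∀ i j, (structureSheaf Z).obj.obj
      (op ((Opens.map g.hom.base).obj (B i) ⊓ (Opens.map g.hom.base).obj (B j))) :=
      fun i j => comorphismLE g (map_inf_le g _ _) (y i j)
    obtain ⟨b, hb⟩ := exists_ring_coboundary hH hcov c (fun i j k V hi hj hk => by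
      let Ai : B i ⊓ B j ⊓ B k ≤ B i := inf_le_left.trans inf_le_left
      let Aj : B i ⊓ B j ⊓ B k ≤ B j := inf_le_left.trans inf_le_right
      let Ak : B i ⊓ B j ⊓ B k ≤ B k := inf_le_right
      have h := (hB' i j k).comorphismLE (V := (Opens.map g.hom.base).obj (B i ⊓ B j ⊓ B k)) rfl
      let π := comorphismLE g (le_refl ((Opens.map g.hom.base).obj (B i ⊓ B j ⊓ B k)))
      let r := fun {i' j' : ι} (hi' : B i ⊓ B j ⊓ B k ≤ B i') (hj' : B i ⊓ B j ⊓ B k ≤ B j') =>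
        ringRes (structureSheaf W) (le_inf hi' hj')
      have hpi : ∀ {i' j' : ι} (hi' : B i ⊓ B j ⊓ B k ≤ B i') (hj' : B i ⊓ B j ⊓ B k ≤ B j'),
          π (r hi' hj' (e i' j')) =
          ringRes (structureSheaf Z) (le_inf ((Opens.map g.hom.base).monotone hi')
            ((Opens.map g.hom.base).monotone hj')) (q i' j') := fun hi' hj' => by
        rw [comorphismLE_ringRes, ← he, ringRes_comorphismLE]
      have hE : π (r Ai Aj (e i j) * r Aj Ak (e j k)) = π (r Ai Ak (e i k)) := by
        rw [map_mul, hpi Ai Aj, hpi Aj Ak, hpi Ai Ak]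
        exact hq.mul i j k _ ((Opens.map g.hom.base).monotone Ai)
          ((Opens.map g.hom.base).monotone Aj) ((Opens.map g.hom.base).monotone Ak)
      have hM := hm.mul i j k _ Ai Aj Ak
      rw [hy, hy, hy] at hM
      simp only [map_mul, map_add, map_pow, map_one, map_natCast] at hM
      change r Ai Aj (e i j) ^ l * (1 + l * r Ai Aj (y i j)) *
        (r Aj Ak (e j k) ^ l * (1 + l * r Aj Ak (y j k))) =
          r Ai Ak (e i k) ^ l * (1 + l * r Ai Ak (y i k)) at hM
      -- elements that agree modulo `l` have `l`-th powers that agree modulo `l ^ 2`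
      obtain ⟨z, hz⟩ := h.exists_eq_add_mul hE
      obtain ⟨d, hd⟩ : ((l : ℕ) : (structureSheaf W).obj.obj (op (B i ⊓ B j ⊓ B k))) ^ (1 + 1) ∣
          (r Ai Aj (e i j) * r Aj Ak (e j k)) ^ l ^ 1 - r Ai Ak (e i k) ^ l ^ 1 :=
        dvd_sub_pow_of_dvd_sub ⟨z, by rw [hz]; ring⟩ 1
      rw [pow_one] at hd
      have hunit : IsUnit (r Ai Ak (e i k) ^ l) := ((hu i k).map _).pow l
      obtain ⟨d', hd'⟩ := hunit.exists_right_inv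
      have hsum : r Ai Aj (y i j) + r Aj Ak (y j k) = r Ai Ak (y i k) +
          l * (-(d' * d * (1 + l * r Ai Aj (y i j)) * (1 + l * r Aj Ak (y j k)) +
            r Ai Aj (y i j) * r Aj Ak (y j k))) := by
        apply h.mul_cancel
        linear_combination d' * hM - d' * (1 + l * r Ai Aj (y i j)) * (1 + l * r Aj Ak (y j k)) * hd
          + ((1 + l * r Ai Ak (y i k)) -
            (1 + l * r Ai Aj (y i j)) * (1 + l * r Aj Ak (y j k))) * hd'
      have hV : V ≤ (Opens.map g.hom.base).obj (B i ⊓ B j ⊓ B k) := le_inf (le_inf hi hj) hk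
      have hs := congr_arg (comorphismLE g hV) hsum
      have hp0 : comorphismLE g hV (l : (structureSheaf W).obj.obj (op (B i ⊓ B j ⊓ B k))) = 0 := by
        rw [← ringRes_comorphismLE (le_refl _) hV, h.map_prime, map_zero]
      rw [map_add, map_add, map_mul, hp0, zero_mul, add_zero, comorphismLE_ringRes,
        comorphismLE_ringRes, comorphismLE_ringRes] at hs
      rw [ringRes_comorphismLE, ringRes_comorphismLE, ringRes_comorphismLE]
      exact hs)
    have h₁ : ∀ i, IsCompleteReduction l
        (comorphismLE g (le_refl ((Opens.map g.hom.base).obj (B i)))) :=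
      fun i => (hB₁ i).comorphismLE rfl
    -- `1 + l β i` is the unit by whose coboundary `m` is multiplied
    choose β hβ using fun i => (h₁ i).surjective (b i)
    choose s hs using fun i => ((h₁ i).isUnit_one_add (β i)).exists_right_inv
    have hx : ∀ i j, ∃ x : (structureSheaf W).obj.obj (op (B i ⊓ B j)),
        (e i j * (1 + (l : (structureSheaf W).obj.obj (op (B i ⊓ B j))) * x)) ^ l =
          m i j * ringRes _ inf_le_right
            (1 + (l : (structureSheaf W).obj.obj (op (B j))) * β j) *
              ringRes _ inf_le_left (s i) := fun i j => by
      let βi := ringRes (structureSheaf W) (inf_le_left : B i ⊓ B j ≤ B i) (β i)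
      let βj := ringRes (structureSheaf W) (inf_le_right : B i ⊓ B j ≤ B j) (β j)
      let si := ringRes (structureSheaf W) (inf_le_left : B i ⊓ B j ≤ B i) (s i)
      have hsi : (1 + l * βi) * si = 1 := by
        have := congr_arg (ringRes (structureSheaf W) (inf_le_left : B i ⊓ B j ≤ B i)) (hs i)
        rwa [map_mul, map_add, map_mul, map_natCast, map_one] at this
      have hyb : comorphismLE g (map_inf_le g (B i) (B j)) (y i j) =
          comorphismLE g (map_inf_le g (B i) (B j)) (βi - βj) := by
        rw [map_sub, comorphismLE_ringRes, comorphismLE_ringRes]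
        refine (hb i j).trans ?_
        rw [← hβ, ← hβ, ringRes_comorphismLE, ringRes_comorphismLE]
      obtain ⟨t, ht⟩ := (h₂ i j).exists_eq_add_mul hyb
      obtain ⟨x, hx, -⟩ := (h₂ i j).existsUnique_pow_prime hp hp2
        ((t + (βi - βj) * βj + l * t * βj) * si)
      refine ⟨x, ?_⟩
      rw [mul_pow, hx, hy, map_add, map_mul, map_natCast, map_one, ht]
      linear_combination -(e i j ^ l) * hsi
    choose x hx using hx
    exact ⟨fun i j => e i j * (1 + l * x i j), isCocycle_of_pow_eq hp hp2 hB hB' hl hq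
      (hm.twist hs) hx (fun i j => hmod i j _), fun i j => hmod i j _⟩
  · choose x hx _ using fun i j => (h₂ i j).existsUnique_pow_coprime
      ((Nat.coprime_primes hl hp).2 hlp) (y i j)
    exact ⟨fun i j => e i j * (1 + p * x i j), isCocycle_of_pow_eq hp hp2 hB hB' hl hq hm
      (fun i j => by rw [hy, mul_pow, hx]) (fun i j => hmod i j _), fun i j => hmod i j _⟩

/-- If `W` has enough open sets over which `O_W` is complete with reduction `O_Z`, then an
invertible sheaf on `Z` lifts to `W` if a power of prime exponent lifts. -/
theorem IsLiftable.of_pow (hp : p.Prime) (hp2 : p ≠ 2) (hH : Subsingleton (H1 Z))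
    (hg : Function.Surjective g.hom.base) (𝓑 : Set (Opens W.carrier))
    (h𝓑 : ∀ U ∈ 𝓑, IsCompleteReduction p (comorphism g U))
    (hinf : ∀ U ∈ 𝓑, ∀ V ∈ 𝓑, U ⊓ V ∈ 𝓑)
    (hbasis : ∀ (x : Z.carrier) (V : Opens Z.carrier), x ∈ V →
      ∃ U ∈ 𝓑, x ∈ (Opens.map g.hom.base).obj U ∧ (Opens.map g.hom.base).obj U ≤ V)
    {l : ℕ} (hl : l.Prime) {a : Pic (structureSheaf Z)} (ha : IsLiftable g (a ^ l)) :
    IsLiftable g a := by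
  obtain ⟨V, hV, m, hm, hm'⟩ := ha.exists_hasCocycle
  obtain ⟨L, rfl⟩ := Quotient.exists_rep a
  obtain ⟨U, hU, s, q, hq⟩ := L.exists_isTriv
  -- a covering that refines the coverings of both cocycles
  choose B hB hxB hBU using fun x => hbasis x (U x ⊓ (Opens.map g.hom.base).obj (V (g.hom.base x)))
    ⟨hU x, hV _⟩
  have hBV : ∀ x, B x ≤ V (g.hom.base x) := fun x y hy => by
    obtain ⟨z, rfl⟩ := hg y
    exact (hBU x hy).2
  have hq' : HasCocycle (Pic.mk L) _ _ := HasCocycle.restrict ⟨L, s, rfl, hq⟩ id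
    (V := fun x => (Opens.map g.hom.base).obj (B x)) fun x => (hBU x).trans inf_le_left
  have hm₁ := hm.restrict (fun x => g.hom.base x) hBV
  have hm₂ := hm'.restrict (fun x => g.hom.base x) fun x => (Opens.map g.hom.base).monotone (hBV x)
  obtain ⟨w, hw, hwq⟩ := hm₂.exists_coboundary (hq'.pow l)
  have h₁ := fun x => (h𝓑 _ (hB x)).comorphismLE rfl
  -- lift the coboundary that compares `q ^ l` with the liftable cocycle
  choose w₁ hw₁ using fun x => (h₁ x).surjective (w x)
  choose w₂ hw₂ using fun x =>
    ((h₁ x).isUnit_of_map (x := w₁ x) (by rw [hw₁]; exact hw x)).exists_right_inv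
  obtain ⟨e, he, heq⟩ := exists_lift_of_pow_lift hp hp2 hH (fun x => h𝓑 _ (hB x))
    (fun x y => h𝓑 _ (hinf _ (hB x) _ (hB y)))
    (fun x y z => h𝓑 _ (hinf _ (hinf _ (hB x) _ (hB y)) _ (hB z))) (fun x => ⟨x, hxB x⟩) hl
    hq'.isCocycle (hm₁.twist hw₂) fun x y => by
      have h3 := congr_arg (comorphismLE g
        (inf_le_left : (Opens.map g.hom.base).obj (B x) ⊓ (Opens.map g.hom.base).obj (B y) ≤ _))
        (hw₂ x)
      have h4 := hwq x y
      rw [map_mul, map_one, ← ringRes_comorphismLE (V := (Opens.map g.hom.base).obj (B x)) le_rfl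
        inf_le_left, hw₁] at h3
      rw [ringRes_comorphismLE] at h4
      rw [map_mul, map_mul, comorphismLE_ringRes, comorphismLE_ringRes, comorphismLE_ringRes,
        ← ringRes_comorphismLE (V := (Opens.map g.hom.base).obj (B y)) le_rfl inf_le_right, hw₁,
        h4, mul_right_comm, h3, one_mul]
  refine IsLiftable.of_hasCocycle (fun y => ?_) he (hq'.congr fun x y => (heq x y).symm)
  obtain ⟨x, rfl⟩ := hg y
  exact ⟨x, hxB x⟩

end Roots

/-! ### Torsion in the quotient -/

section Torsion

/-- A quotient of a commutative group is torsion-free as soon as it has no torsion of prime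
order. -/
lemma isMulTorsionFree_quotient {G : Type*} [CommGroup G] {P : Subgroup G}
    (h : ∀ l : ℕ, l.Prime → ∀ a : G, a ^ l ∈ P → a ∈ P) : IsMulTorsionFree (G ⧸ P) := by
  have key : ∀ n : ℕ, n ≠ 0 → ∀ a : G, a ^ n ∈ P → a ∈ P := by
    intro n
    induction n using Nat.recOnMul with
    | zero => exact fun h0 => absurd rfl h0
    | one => exact fun _ a ha => by rwa [pow_one] at ha
    | prime l hl => exact fun _ => h l hl
    | mul m n hm hn =>
      intro hmn a ha
      rw [pow_mul] at ha
      exact hm (left_ne_zero_of_mul hmn) a (hn (right_ne_zero_of_mul hmn) _ ha)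
  refine ⟨fun n hn x y hxy => ?_⟩
  induction x using QuotientGroup.induction_on with | _ a
  induction y using QuotientGroup.induction_on with | _ b
  refine QuotientGroup.eq.2 (key n hn _ ?_)
  rw [mul_pow, inv_pow]
  exact QuotientGroup.eq.1 hxy

/-- Affine open sets of a scheme that is separated over an affine scheme intersect in affine open
sets. -/
lemma isAffineOpen_inf {X S : Scheme.{u}} [IsAffine S] (f : X ⟶ S) [IsSeparated f]
    {U V : X.Opens} (hU : IsAffineOpen U) (hV : IsAffineOpen V) : IsAffineOpen (U ⊓ V) :=
  isAffineHom_diagonal_iff.1 (inferInstance : IsAffineHom (Limits.pullback.diagonal f)) ⊤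
    (isAffineOpen_top _) U le_top V le_top hU hV

variable {p : ℕ} [Fact p.Prime] {X : Scheme.{0}} (f : X ⟶ Spec (.of ℤ_[p]))

/-- The affine open subsets of `X` cut out a basis of the topology of `X_p`. -/
lemma exists_isAffineOpen_preimage_le {x : thickening f 1} {V : (thickening f 1).Opens}
    (hx : x ∈ V) : ∃ W : X.Opens, IsAffineOpen W ∧ x ∈ thickeningι f 1 ⁻¹ᵁ W ∧
      thickeningι f 1 ⁻¹ᵁ W ≤ V := by
  obtain ⟨V', hV', hV⟩ := (thickeningι f 1).isClosedEmbedding.isInducing.isOpen_iff.1 V.2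
  have hx' : thickeningι f 1 x ∈ (⟨V', hV'⟩ : X.Opens) := by
    change x ∈ thickeningι f 1 ⁻¹' V'
    rw [hV]
    exact hx
  obtain ⟨W, hW, hxW, hWV⟩ := X.isBasis_affineOpens.exists_subset_of_mem_open hx' hV'
  obtain ⟨W, hW, rfl⟩ := hW
  refine ⟨W, hW, hxW, fun y hy => ?_⟩
  change y ∈ V.carrier
  rw [← hV]
  exact hWV hy

end Torsion

end

end PicardLift

theorem mainTheorem2 (p : ℕ) [Fact p.Prime] (hp : p ≠ 2)
    (X : AlgebraicGeometry.Scheme.{0}) (f : X ⟶ AlgebraicGeometry.Spec (CommRingCat.of ℤ_[p]))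
    [AlgebraicGeometry.IsNoetherian X] [AlgebraicGeometry.IsSeparated f]
    [AlgebraicGeometry.Flat f]
    (hH : Subsingleton (PicardLift.H1 (PicardLift.specialFiber f))) :
    ∃ P : Subgroup (PicardLift.Pic (PicardLift.structureSheaf (PicardLift.specialFiber f))),
      (P : Set (PicardLift.Pic (PicardLift.structureSheaf (PicardLift.specialFiber f)))) =
          PicardLift.liftable f ∧
        IsMulTorsionFree
          (PicardLift.Pic (PicardLift.structureSheaf (PicardLift.specialFiber f)) ⧸ P) := by
  refine ⟨PicardLift.liftableSubgroup (PicardLift.specialFiberInclusion f), rfl,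
    PicardLift.isMulTorsionFree_quotient fun l hl a ha => ?_⟩
  refine PicardLift.IsLiftable.of_pow (g := PicardLift.specialFiberInclusion f)
    (Fact.out : p.Prime) hp hH (fun x => ⟨x, rfl⟩)
    {U | ∃ W : X.Opens, IsAffineOpen W ∧ PicardLift.thickeningι f 1 ⁻¹ᵁ W = U} ?_ ?_ ?_ hl ha
  · rintro _ ⟨W, hW, rfl⟩
    exact PicardLift.isCompleteReduction_comorphism f hW
  · rintro _ ⟨W, hW, rfl⟩ _ ⟨W', hW', rfl⟩
    exact ⟨W ⊓ W', PicardLift.isAffineOpen_inf f hW hW', rfl⟩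
  · intro x V hx
    obtain ⟨W, hW, hxW, hWV⟩ := PicardLift.exists_isAffineOpen_preimage_le f hx
    exact ⟨_, ⟨W, hW, rfl⟩, hxW, hWV⟩
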